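/- Let $d\ge 1$, $Q_0=[0,1]^d\subset\mathbb R^d$, and let $BV(Q_0)$ be the space of all real $u\in L^1(Q_0)$ with $$V[u]=\sup\Big\{\int_{Q_0}u\,\mathrm{div}\,\psi\,dx:\ \psi\in C_c^\infty((0,1)^d;\mathbb R^d),\ |\psi(x)|\le 1\text{ for all }x\Big\}<\infty,$$ where $|\cdot|$ is the Euclidean norm, with the norm $\|u\|_{BV}=\|u\|_{L^1}+V[u]$. Let $C_0(Q_0)$ and $C_0(Q_0;\mathbb R^d)$ be the spaces of continuous functions on $Q_0$, with values in $\mathbb R$ and $\mathbb R^d$, that vanish on $\partial Q_0$. For $\phi\in C_0(Q_0;\mathbb R^d)$ let $\mathrm{div}\,\phi\in BV(Q_0)^*$ be the functional $u\mapsto\lim_k\int_{Q_0}u\,\mathrm{div}\,\psi_k\,dx$, where $\psi_k\in C_c^\infty((0,1)^d;\mathbb R^d)$ is any sequence converging uniformly to $\phi$; and identify $\varphi\in C_0(Q_0)$ with the functional $u\mapsto\int_{Q_0}u\varphi\,dx$. Let $$W(Q_0)=\{\varphi+\mathrm{div}\,\phi:\ \varphi\in C_0(Q_0),\ \phi\in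 C_0(Q_0;\mathbb R^d)\}\subset BV(Q_0)^*,$$ with the norm of $BV(Q_0)^*$. Call a subspace $P\subset BV(Q_0)^*$ an isometric predual of $BV(Q_0)$ if it is closed and the map $BV(Q_0)\to P^*$, $u\mapsto(f\mapsto f(u))$, is an isometric isomorphism onto $P^*$. Call a Banach space $Y$ a strongly unique predual if the only norm one projection of $Y^{***}$ onto $Y^*$ with weak-star closed kernel is the canonical one, $\xi\mapsto\xi|_Y$ (where $Y\subset Y^{**}$ and $Y^*\subset Y^{***}$ canonically). Then $W(Q_0)$ is an isometric predual of $BV(Q_0)$, but it is not a strongly unique predual. Moreover, there is an isometric predual $P\subset BV(Q_0)^*$ of $BV(Q_0)$ with $P\ne W(Q_0)$. -/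

import Mathlib

set_option maxSynthPendingDepth 3

open MeasureTheory Filter Topology NormedSpace
open scoped ENNReal Distributions

noncomputable section

/-- The closed unit cube `Q₀ = [0,1]^d` of Euclidean space. -/
def unitCube (d : ℕ) : Set (EuclideanSpace ℝ (Fin d)) :=
  {x | ∀ i, x i ∈ Set.Icc (0 : ℝ) 1}

/-- The interior `(0,1)^d` of the unit cube. -/
def openCube (d : ℕ) : TopologicalSpace.Opens (EuclideanSpace ℝ (Fin d)) where
  carrier := {x | ∀ i, x i ∈ Set.Ioo (0 : ℝ) 1}
  is_open' := by
    simp only [Set.ofPred_forall]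
    refine isOpen_iInter_of_finite fun i => ?_
    exact isOpen_Ioo.preimage (by fun_prop : Continuous fun x : EuclideanSpace ℝ (Fin d) => x i)

/-- The space `L¹(Q₀)` of real functions. -/
abbrev L1Cube (d : ℕ) : Type := Lp ℝ 1 ((volume : Measure (EuclideanSpace ℝ (Fin d))).restrict (unitCube d))

/-- Test fields: smooth vector fields with compact support in the open unit cube. -/
abbrev TestField (d : ℕ) : Type := 𝓓(openCube d, EuclideanSpace ℝ (Fin d))

/-- The divergence `∑ i, ∂ψᵢ/∂xᵢ` of a vector field. -/
def divergence {d : ℕ} (ψ : EuclideanSpace ℝ (Fin d) → EuclideanSpace ℝ (Fin d))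
    (x : EuclideanSpace ℝ (Fin d)) : ℝ :=
  ∑ i, fderiv ℝ ψ x (EuclideanSpace.single i 1) i

/-- The pairing `∫_{Q₀} u div ψ dx` of an integrable function with a test field. -/
def divPairing {d : ℕ} (u : L1Cube d) (ψ : TestField d) : ℝ :=
  ∫ x in unitCube d, u x * divergence ψ x

/-- The total variation `V[u] ∈ [0, ∞]`: the supremum of `∫_{Q₀} u div ψ dx` over the test fields
with `|ψ(x)| ≤ 1` everywhere (the zero field gives the value `0`). -/
def variation {d : ℕ} (u : L1Cube d) : ℝ≥0∞ :=
  ⨆ (ψ : TestField d) (_ : ∀ x, ‖ψ x‖ ≤ 1), ENNReal.ofReal (divPairing u ψ)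

section Lemmas

variable {d : ℕ}

lemma continuous_divergence (ψ : TestField d) : Continuous (divergence ψ) := by
  have h : Continuous (fderiv ℝ ψ) := ψ.contDiff.continuous_fderiv (by simp)
  unfold divergence
  refine continuous_finsetSum _ fun i _ => ?_
  have h2 : Continuous fun x => fderiv ℝ ψ x (EuclideanSpace.single i 1) :=
    h.clm_apply continuous_const
  fun_prop

lemma hasCompactSupport_divergence (ψ : TestField d) : HasCompactSupport (divergence ψ) := by
  refine (ψ.hasCompactSupport.fderiv ℝ).mono' ?_
  refine (Function.support_subset_iff'.2 fun x hx => ?_).trans subset_closure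
  have hx' : fderiv ℝ ψ x = 0 := by simpa using hx
  simp [divergence, hx']

lemma integrable_mul_divergence (u : L1Cube d) (ψ : TestField d) :
    Integrable (fun x => u x * divergence ψ x) (volume.restrict (unitCube d)) := by
  obtain ⟨C, hC⟩ :=
    (hasCompactSupport_divergence ψ).exists_bound_of_continuous (continuous_divergence ψ)
  exact (L1.integrable_coeFn u).mul_bdd (c := C)
    (continuous_divergence ψ).aestronglyMeasurable (Eventually.of_forall hC)

lemma divergence_add (ψ χ : TestField d) (x : EuclideanSpace ℝ (Fin d)) :
    divergence (ψ + χ : TestField d) x = divergence ψ x + divergence χ x := by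
  have h1 := (ψ.contDiff.differentiable (by simp)).differentiableAt (x := x)
  have h2 := (χ.contDiff.differentiable (by simp)).differentiableAt (x := x)
  have : fderiv ℝ (ψ + χ : TestField d) x = fderiv ℝ ψ x + fderiv ℝ χ x := by
    exact fderiv_add h1 h2
  simp only [divergence, this, ← Finset.sum_add_distrib]
  rfl

lemma divergence_smul (c : ℝ) (ψ : TestField d) (x : EuclideanSpace ℝ (Fin d)) :
    divergence (c • ψ : TestField d) x = c * divergence ψ x := by
  have h1 := (ψ.contDiff.differentiable (by simp)).differentiableAt (x := x)
  have : fderiv ℝ (c • ψ : TestField d) x = c • fderiv ℝ ψ x := by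
    exact fderiv_const_smul h1 c
  simp only [divergence, this, Finset.mul_sum]
  rfl

lemma divPairing_add_left (u v : L1Cube d) (ψ : TestField d) :
    divPairing (u + v) ψ = divPairing u ψ + divPairing v ψ := by
  unfold divPairing
  rw [← integral_add (integrable_mul_divergence u ψ) (integrable_mul_divergence v ψ)]
  refine integral_congr_ae ?_
  filter_upwards [Lp.coeFn_add u v] with x hx
  rw [hx, Pi.add_apply, add_mul]

lemma divPairing_smul_left (c : ℝ) (u : L1Cube d) (ψ : TestField d) :
    divPairing (c • u) ψ = c * divPairing u ψ := by
  unfold divPairing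
  rw [← integral_const_mul]
  refine integral_congr_ae ?_
  filter_upwards [Lp.coeFn_smul c u] with x hx
  rw [hx, Pi.smul_apply, smul_eq_mul, mul_assoc]

lemma divPairing_add_right (u : L1Cube d) (ψ χ : TestField d) :
    divPairing u (ψ + χ) = divPairing u ψ + divPairing u χ := by
  unfold divPairing
  rw [← integral_add (integrable_mul_divergence u ψ) (integrable_mul_divergence u χ)]
  simp only [divergence_add, mul_add]

lemma divPairing_smul_right (c : ℝ) (u : L1Cube d) (ψ : TestField d) :
    divPairing u (c • ψ) = c * divPairing u ψ := by
  unfold divPairing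
  rw [← integral_const_mul]
  simp only [divergence_smul, mul_left_comm]

lemma variation_add_le (u v : L1Cube d) : variation (u + v) ≤ variation u + variation v := by
  refine iSup₂_le fun ψ hψ => ?_
  rw [divPairing_add_left]
  exact ENNReal.ofReal_add_le.trans (add_le_add
    (le_iSup₂ (f := fun (ψ : TestField d) (_ : ∀ x, ‖ψ x‖ ≤ 1) =>
      ENNReal.ofReal (divPairing u ψ)) ψ hψ)
    (le_iSup₂ (f := fun (ψ : TestField d) (_ : ∀ x, ‖ψ x‖ ≤ 1) =>
      ENNReal.ofReal (divPairing v ψ)) ψ hψ))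

lemma variation_smul_le (c : ℝ) (u : L1Cube d) :
    variation (c • u) ≤ ENNReal.ofReal |c| * variation u := by
  refine iSup₂_le fun ψ hψ => ?_
  have key : ∃ χ : TestField d, (∀ x, ‖χ x‖ ≤ 1) ∧
      divPairing (c • u) ψ = |c| * divPairing u χ := by
    rcases le_total 0 c with hc | hc
    · exact ⟨ψ, hψ, by rw [divPairing_smul_left, abs_of_nonneg hc]⟩
    · refine ⟨(-1 : ℝ) • ψ, fun x => by simpa using hψ x, ?_⟩
      rw [divPairing_smul_left, divPairing_smul_right, abs_of_nonpos hc]; ring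
  obtain ⟨χ, hχ, h⟩ := key
  rw [h, ENNReal.ofReal_mul (abs_nonneg c)]
  gcongr
  exact le_iSup₂ (f := fun (ψ : TestField d) (_ : ∀ x, ‖ψ x‖ ≤ 1) =>
      ENNReal.ofReal (divPairing u ψ)) χ hχ

lemma variation_zero : variation (0 : L1Cube d) = 0 := by
  have h := variation_smul_le 0 (0 : L1Cube d)
  simpa using h

end Lemmas

/-- The linear subspace of `L¹(Q₀)` of the functions of finite total variation. -/
def bvSubmodule (d : ℕ) : Submodule ℝ (L1Cube d) where
  carrier := {u | variation u < ∞}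
  add_mem' {u v} hu hv := (variation_add_le u v).trans_lt (ENNReal.add_lt_top.2 ⟨hu, hv⟩)
  zero_mem' := by simp [variation_zero]
  smul_mem' c u hu :=
    (variation_smul_le c u).trans_lt (ENNReal.mul_lt_top ENNReal.ofReal_lt_top hu)

/-- The space `BV(Q₀)`. It is a type of its own, since its norm is not the one of `L¹(Q₀)`. -/
def BV (d : ℕ) : Type := ↥(bvSubmodule d)

namespace BV

variable {d : ℕ}

instance : AddCommGroup (BV d) := inferInstanceAs (AddCommGroup ↥(bvSubmodule d))

instance : Module ℝ (BV d) := inferInstanceAs (Module ℝ ↥(bvSubmodule d))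

/-- The inclusion of `BV(Q₀)` into `L¹(Q₀)`. -/
def toL1 : BV d →ₗ[ℝ] L1Cube d := (bvSubmodule d).subtype

lemma variation_lt_top (u : BV d) : variation (toL1 u) < ∞ := Subtype.property u

lemma toL1_injective : Function.Injective (toL1 (d := d)) := Subtype.val_injective

/-- The norm `‖u‖_{L¹(Q₀)} + V[u]`. -/
instance : Norm (BV d) := ⟨fun u => ‖toL1 u‖ + (variation (toL1 u)).toReal⟩

lemma norm_def (u : BV d) : ‖u‖ = ‖toL1 u‖ + (variation (toL1 u)).toReal := rfl

lemma norm_smul_le' (c : ℝ) (u : BV d) : ‖c • u‖ ≤ |c| * ‖u‖ := by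
  have h : (variation (c • toL1 u)).toReal ≤ |c| * (variation (toL1 u)).toReal := by
    have := ENNReal.toReal_mono
      (ENNReal.mul_lt_top ENNReal.ofReal_lt_top (variation_lt_top u)).ne
      (variation_smul_le c (toL1 u))
    simpa [ENNReal.toReal_mul] using this
  rw [norm_def, norm_def, map_smul, norm_smul, Real.norm_eq_abs, mul_add]
  gcongr

lemma normCore : NormedSpace.Core ℝ (BV d) where
  norm_nonneg u := by rw [norm_def]; positivity
  norm_smul c u := by
    rw [Real.norm_eq_abs]
    refine le_antisymm (norm_smul_le' c u) ?_
    rcases eq_or_ne c 0 with rfl | hc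
    · rw [abs_zero, zero_mul, norm_def]; positivity
    · have h := norm_smul_le' c⁻¹ (c • u)
      rw [smul_smul, inv_mul_cancel₀ hc, one_smul, abs_inv] at h
      rwa [le_inv_mul_iff₀ (abs_pos.2 hc)] at h
  norm_triangle u v := by
    have h : (variation (toL1 u + toL1 v)).toReal ≤
        (variation (toL1 u)).toReal + (variation (toL1 v)).toReal := by
      rw [← ENNReal.toReal_add (variation_lt_top u).ne (variation_lt_top v).ne]
      exact ENNReal.toReal_mono
        (ENNReal.add_lt_top.2 ⟨variation_lt_top u, variation_lt_top v⟩).ne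
        (variation_add_le _ _)
    have h2 := norm_add_le (toL1 u) (toL1 v)
    rw [norm_def, norm_def, norm_def, map_add]
    linarith
  norm_eq_zero_iff u := by
    constructor
    · intro h
      rw [norm_def] at h
      have h1 : ‖toL1 u‖ = 0 :=
        le_antisymm (by linarith [ENNReal.toReal_nonneg (a := variation (toL1 u))]) (norm_nonneg _)
      exact toL1_injective (by rw [norm_eq_zero.1 h1, map_zero])
    · rintro rfl
      rw [norm_def, map_zero, variation_zero]; simp

instance : NormedAddCommGroup (BV d) := NormedAddCommGroup.ofCore normCore

instance : NormedSpace ℝ (BV d) := NormedSpace.ofCore normCore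

end BV

/-- Membership in `C₀(Q₀)` or `C₀(Q₀; ℝ^d)`: continuous functions on the cube that vanish on its
boundary, here extended by zero to the whole space. -/
def IsC0 {d : ℕ} {F : Type*} [TopologicalSpace F] [Zero F]
    (φ : EuclideanSpace ℝ (Fin d) → F) : Prop :=
  Continuous φ ∧ ∀ x, x ∉ openCube d → φ x = 0

/-- `IsDiv ϕ D` says that `D ∈ BV(Q₀)*` is the functional `div ϕ` for the field `ϕ ∈ C₀(Q₀; ℝ^d)`.
On test fields `div ψ` acts by `u ↦ ∫ u div ψ dx`; since this is at most `V[u] ‖ψ‖_∞` in absolute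
value, the action extends by continuity to all uniform limits of test fields. (So
`D u = - ∫ ϕ · dDu`.) -/
def IsDiv {d : ℕ} (ϕ : EuclideanSpace ℝ (Fin d) → EuclideanSpace ℝ (Fin d))
    (D : StrongDual ℝ (BV d)) : Prop :=
  ∃ ψ : ℕ → TestField d, TendstoUniformly (fun k x => ψ k x) ϕ atTop ∧
    ∀ u : BV d, Tendsto (fun k => divPairing (BV.toL1 u) (ψ k)) atTop (𝓝 (D u))

lemma IsC0.integrable_mul {d : ℕ} {φ : EuclideanSpace ℝ (Fin d) → ℝ} (hφ : IsC0 φ)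
    (u : L1Cube d) : Integrable (fun x => u x * φ x) (volume.restrict (unitCube d)) := by
  have hb : Bornology.IsBounded (openCube d : Set (EuclideanSpace ℝ (Fin d))) := by
    refine (Metric.isBounded_iff_subset_closedBall 0).2 ⟨√(d : ℝ), fun x hx => ?_⟩
    rw [mem_closedBall_zero_iff, EuclideanSpace.norm_eq]
    refine Real.sqrt_le_sqrt ?_
    calc ∑ i, ‖x i‖ ^ 2 ≤ ∑ _i : Fin d, (1 : ℝ) := by
          refine Finset.sum_le_sum fun i _ => ?_
          have := hx i
          rw [Real.norm_eq_abs, sq_abs]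
          nlinarith [this.1, this.2]
      _ = d := by simp
  have hs : HasCompactSupport φ :=
    HasCompactSupport.intro hb.isCompact_closure fun x hx => hφ.2 x fun h => hx (subset_closure h)
  obtain ⟨C, hC⟩ := hs.exists_bound_of_continuous hφ.1
  exact (L1.integrable_coeFn u).mul_bdd (c := C) hφ.1.aestronglyMeasurable (Eventually.of_forall hC)

/-- The space `W(Q₀) = {φ + div ϕ : φ ∈ C₀(Q₀), ϕ ∈ C₀(Q₀; ℝ^d)}`, a subspace of `BV(Q₀)*`;
it carries the norm of `BV(Q₀)*`. -/
def W (d : ℕ) : Submodule ℝ (StrongDual ℝ (BV d)) where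
  carrier := {f | ∃ (φ : EuclideanSpace ℝ (Fin d) → ℝ)
      (ϕ : EuclideanSpace ℝ (Fin d) → EuclideanSpace ℝ (Fin d)) (D : StrongDual ℝ (BV d)),
      IsC0 φ ∧ IsC0 ϕ ∧ IsDiv ϕ D ∧
      ∀ u : BV d, f u = (∫ x in unitCube d, BV.toL1 u x * φ x) + D u}
  add_mem' := by
    rintro f g ⟨φ, ϕ, D, hφ, hϕ, ⟨ψ, hψ, hD⟩, hf⟩ ⟨φ', ϕ', D', hφ', hϕ', ⟨ψ', hψ', hD'⟩, hg⟩
    refine ⟨φ + φ', ϕ + ϕ', D + D', ⟨hφ.1.add hφ'.1, fun x hx => ?_⟩,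
      ⟨hϕ.1.add hϕ'.1, fun x hx => ?_⟩, ⟨fun k => ψ k + ψ' k, ?_, fun u => ?_⟩, fun u => ?_⟩
    · simp [hφ.2 x hx, hφ'.2 x hx]
    · simp [hϕ.2 x hx, hϕ'.2 x hx]
    · exact hψ.add hψ'
    · simpa [divPairing_add_right] using (hD u).add (hD' u)
    · have := integral_add (hφ.integrable_mul (BV.toL1 u)) (hφ'.integrable_mul (BV.toL1 u))
      simp only [Pi.add_apply, mul_add, _root_.add_apply, hf u, hg u, this]
      ring
  zero_mem' := by
    refine ⟨0, 0, 0, ⟨continuous_zero, fun _ _ => rfl⟩, ⟨continuous_zero, fun _ _ => rfl⟩,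
      ⟨fun _ => 0, ?_, fun u => ?_⟩, fun u => by simp⟩
    · refine Metric.tendstoUniformly_iff.2 fun ε hε => Eventually.of_forall fun k x => ?_
      simpa using hε
    · have h0 : divPairing (BV.toL1 u) (0 : TestField d) = 0 := by
        simpa using divPairing_smul_right 0 (BV.toL1 u) (0 : TestField d)
      simp [h0]
  smul_mem' := by
    rintro c f ⟨φ, ϕ, D, hφ, hϕ, ⟨ψ, hψ, hD⟩, hf⟩
    refine ⟨c • φ, c • ϕ, c • D, ⟨hφ.1.const_smul c, fun x hx => ?_⟩,
      ⟨hϕ.1.const_smul c, fun x hx => ?_⟩, ⟨fun k => c • ψ k, ?_, fun u => ?_⟩, fun u => ?_⟩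
    · simp [hφ.2 x hx]
    · simp [hϕ.2 x hx]
    · exact (uniformContinuous_const_smul c).comp_tendstoUniformly hψ
    · simpa [divPairing_smul_right] using (hD u).const_mul c
    · have := integral_const_mul (μ := volume.restrict (unitCube d)) c
        (fun x => BV.toL1 u x * φ x)
      simp only [Pi.smul_apply, smul_eq_mul, mul_left_comm _ c, this,
        _root_.smul_apply, hf u]
      ring

/-- The map `E → P*`, `u ↦ (f ↦ f u)`, given by the duality between `E` and a subspace `P` of
`E*`. -/
def dualityMap {E : Type*} [NormedAddCommGroup E] [NormedSpace ℝ E]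
    (P : Submodule ℝ (StrongDual ℝ E)) (u : E) : StrongDual ℝ P :=
  (inclusionInDoubleDual ℝ E u).comp P.subtypeL

/-- A closed subspace `P` of `E*`, with the norm of `E*`, is an isometric predual of `E` if
`P* ≅ E` isometrically through the duality between `E` and `E*`. -/
def IsIsometricPredual {E : Type*} [NormedAddCommGroup E] [NormedSpace ℝ E]
    (P : Submodule ℝ (StrongDual ℝ E)) : Prop :=
  IsClosed (P : Set (StrongDual ℝ E)) ∧ Isometry (dualityMap P) ∧
    Function.Surjective (dualityMap P)

/-- `Y` is a strongly unique (isometric) predual (of `Y*`): the only norm one projection of `Y***`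
onto (the canonical copy of) `Y*` with weak-star closed kernel is the canonical one, which
restricts an element of `Y***` to the canonical copy of `Y` in `Y**`. -/
def IsStronglyUniquePredual (Y : Type*) [NormedAddCommGroup Y] [NormedSpace ℝ Y] : Prop :=
  ∀ π : StrongDual ℝ (StrongDual ℝ (StrongDual ℝ Y)) →L[ℝ] StrongDual ℝ Y,
    (∀ y : StrongDual ℝ Y, π (inclusionInDoubleDual ℝ (StrongDual ℝ Y) y) = y) →
    ‖π‖ = 1 →
    IsClosed {ξ : WeakDual ℝ (StrongDual ℝ (StrongDual ℝ Y)) | π (WeakDual.toStrongDual ξ) = 0} →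
    ∀ ξ, π ξ = ξ.comp (inclusionInDoubleDual ℝ Y)

end

/-! Write `S (φ, ϕ) = φ + div ϕ` for the operator `toDualBV`, whose range is `W d`. Its domain `C₀ ×
C₀(ℝ^d)` carries the maximum norm, and the unit ball of that domain norms `BV`, because the norm of
`BV` is a sum of two independent suprema. The key fact is `exists_BV_of_vanish`: a functional `Λ`
that vanishes on `ker S` is evaluation at some `u ∈ BV`. Indeed `(div ψ, -ψ) ∈ ker S`, so the first
component of `Λ` is a functional on `C₀` that is bounded by `C ‖ψ‖` on every `div ψ`. Such a
functional is an `L¹` function (`exists_integralPairing_eq`): compare it with its averages over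
small dilations, which are `L¹` functions, and use that `L¹` is closed in `C₀*`. Hence `W` is
isometric to the quotient by `ker S`, so it is closed, and its dual is `BV`.

The second predual comes from a functional `j` (`boundaryFlux`), a weak-star limit of `div (χₖ eᵢ)`
for cutoffs `χₖ` of the open cube. It vanishes on constants. It is not in `W`, because it equals `1`
on boundary layers that tend to `0` in `L¹` with variation at most `1`. Put `P = {f : f - f(1) j ∈
W}`. Since `j(1) = 0`, the map `g ↦ g + g(1) j` is a bijection from `W` onto `P`, so the duality
with `BV` carries over. The unit ball of `P` still norms `BV`: the correction `s (j - div (χₖ eᵢ))`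
lives near the boundary, away from the support of a given test field.

Two distinct isometric preduals exclude strong uniqueness (`not_isStronglyUniquePredual`): each
yields a norm one projection whose kernel is its own annihilator, and a closed subspace is
determined by its annihilator. -/

open scoped BoundedContinuousFunction

noncomputable section

/-! ### Geometry and measure of the cube. -/

section Geometry

variable {d : ℕ}

lemma openCube_subset_unitCube : (openCube d : Set (EuclideanSpace ℝ (Fin d))) ⊆ unitCube d :=
  fun _ hx i => ⟨(hx i).1.le, (hx i).2.le⟩

lemma isClosed_unitCube : IsClosed (unitCube d) := by
  have : unitCube d = ⋂ i, (fun x : EuclideanSpace ℝ (Fin d) => x i) ⁻¹' Set.Icc 0 1 := by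
    ext x; simp [unitCube]
  rw [this]
  exact isClosed_iInter fun i => isClosed_Icc.preimage (by fun_prop)

lemma norm_le_of_mem_unitCube {x : EuclideanSpace ℝ (Fin d)} (hx : x ∈ unitCube d) :
    ‖x‖ ≤ √(d : ℝ) := by
  rw [EuclideanSpace.norm_eq]
  refine Real.sqrt_le_sqrt ?_
  calc ∑ i, ‖x i‖ ^ 2 ≤ ∑ _i : Fin d, (1 : ℝ) := by
        refine Finset.sum_le_sum fun i _ => ?_
        have := hx i
        rw [Real.norm_eq_abs, sq_abs]
        nlinarith [this.1, this.2]
    _ = d := by simp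

lemma isCompact_unitCube : IsCompact (unitCube d) :=
  Metric.isCompact_of_isClosed_isBounded isClosed_unitCube
    ((Metric.isBounded_iff_subset_closedBall 0).2 ⟨√(d : ℝ), fun x hx => by
      rw [mem_closedBall_zero_iff]; exact norm_le_of_mem_unitCube hx⟩)

lemma openCube_ae_eq_unitCube :
    (openCube d : Set (EuclideanSpace ℝ (Fin d))) =ᵐ[volume] unitCube d := by
  have h := (EuclideanSpace.volume_preserving_symm_measurableEquiv_toLp (Fin d)).symm
  have h2 := Measure.univ_pi_Ioo_ae_eq_Icc (μ := fun _ : Fin d => (volume : Measure ℝ))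
    (f := fun _ => 0) (g := fun _ => 1)
  have h3 := (EuclideanSpace.volume_preserving_symm_measurableEquiv_toLp
    (Fin d)).quasiMeasurePreserving.preimage_ae_eq h2
  have e1 : (openCube d : Set (EuclideanSpace ℝ (Fin d))) =
      (MeasurableEquiv.toLp 2 (Fin d → ℝ)).symm ⁻¹' Set.univ.pi fun _ => Set.Ioo 0 1 := by
    ext x; simp [openCube]
  have e2 : unitCube d =
      (MeasurableEquiv.toLp 2 (Fin d → ℝ)).symm ⁻¹' Set.Icc (fun _ => 0) (fun _ => 1) := by
    ext x; simp [unitCube, Set.mem_Icc, Pi.le_def, forall_and]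
  rw [e1, e2]
  exact h3

lemma restrict_unitCube :
    (volume : Measure (EuclideanSpace ℝ (Fin d))).restrict (unitCube d) =
      volume.restrict (openCube d) :=
  (Measure.restrict_congr_set openCube_ae_eq_unitCube).symm

lemma volume_unitCube : (volume : Measure (EuclideanSpace ℝ (Fin d))) (unitCube d) = 1 := by
  have h := (EuclideanSpace.volume_preserving_symm_measurableEquiv_toLp
    (Fin d)).measure_preimage (s := Set.Icc (fun _ => 0) (fun _ => 1))
      measurableSet_Icc.nullMeasurableSet
  rw [Real.volume_Icc_pi] at h
  simp only [sub_zero, ENNReal.ofReal_one, Finset.prod_const_one] at h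
  rw [← h]
  congr 1
  ext x; simp [unitCube, Set.mem_Icc, Pi.le_def, forall_and]

instance isProbabilityMeasure_restrict_unitCube :
    IsProbabilityMeasure ((volume : Measure (EuclideanSpace ℝ (Fin d))).restrict (unitCube d)) :=
  ⟨by simp [volume_unitCube]⟩

lemma ae_mem_openCube :
    ∀ᵐ x ∂((volume : Measure (EuclideanSpace ℝ (Fin d))).restrict (unitCube d)),
      x ∈ openCube d := by
  rw [restrict_unitCube]
  exact ae_restrict_mem (openCube d).isOpen.measurableSet

/-- An expanding dilation about a point of the open cube maps no outer point into the cube. -/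
lemma mem_openCube_of_dilation {p y : EuclideanSpace ℝ (Fin d)} (hp : p ∈ openCube d) {t : ℝ}
    (ht : 0 ≤ t) (h : y + t • (y - p) ∈ openCube d) : y ∈ openCube d := by
  intro i
  have h1 := hp i
  have h2 := h i
  simp only [PiLp.add_apply, PiLp.smul_apply, PiLp.sub_apply, smul_eq_mul, Set.mem_Ioo] at h1 h2
  constructor
  · by_contra hy
    nlinarith
  · by_contra hy
    nlinarith

end Geometry

/-! ### Smooth cutoffs of the open cube. -/

section Cutoff

variable {d : ℕ}

/-- The closed cubes that exhaust the open cube. -/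
def innerCube (d k : ℕ) : Set (EuclideanSpace ℝ (Fin d)) :=
  {x | ∀ i, x i ∈ Set.Icc (1 / ((k : ℝ) + 2)) (1 - 1 / ((k : ℝ) + 2))}

lemma innerCube_eq_iInter (k : ℕ) :
    innerCube d k = ⋂ i, (fun x : EuclideanSpace ℝ (Fin d) => x i) ⁻¹'
      Set.Icc (1 / ((k : ℝ) + 2)) (1 - 1 / ((k : ℝ) + 2)) := by
  ext x; simp [innerCube]

lemma isClosed_innerCube (k : ℕ) : IsClosed (innerCube d k) := by
  rw [innerCube_eq_iInter]
  exact isClosed_iInter fun i => isClosed_Icc.preimage (by fun_prop)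

lemma innerCube_subset (k : ℕ) : innerCube d k ⊆ openCube d := fun x hx i => by
  have := hx i
  have h : 0 < 1 / ((k : ℝ) + 2) := by positivity
  exact ⟨by linarith [this.1], by linarith [this.2]⟩

lemma isCompact_innerCube (k : ℕ) : IsCompact (innerCube d k) :=
  isCompact_unitCube.of_isClosed_subset (isClosed_innerCube k)
    ((innerCube_subset k).trans openCube_subset_unitCube)

lemma eventually_mem_innerCube {x : EuclideanSpace ℝ (Fin d)} (hx : x ∈ openCube d) :
    ∃ n, ∀ k ≥ n, innerCube d k ∈ 𝓝 x := by
  have hlim : Tendsto (fun k : ℕ => 1 / ((k : ℝ) + 2)) atTop (𝓝 0) := by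
    have := tendsto_one_div_add_atTop_nhds_zero_nat (𝕜 := ℝ)
    refine (((tendsto_add_atTop_iff_nat 1).2 this).congr fun k => ?_)
    push_cast; ring
  have h1 : ∀ᶠ k : ℕ in atTop, ∀ i, 1 / ((k : ℝ) + 2) < x i ∧ 1 / ((k : ℝ) + 2) < 1 - x i :=
    eventually_all.2 fun i => (hlim.eventually_lt_const (hx i).1).and
      (hlim.eventually_lt_const (by linarith [(hx i).2] : 0 < 1 - x i))
  obtain ⟨n, hn⟩ := eventually_atTop.1 h1
  refine ⟨n, fun k hk => ?_⟩
  rw [innerCube_eq_iInter]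
  refine (iInter_mem).2 fun i => ?_
  have hc : Continuous fun x : EuclideanSpace ℝ (Fin d) => x i := by fun_prop
  exact hc.continuousAt.preimage_mem_nhds
    (Icc_mem_nhds (hn k hk i).1 (by linarith [(hn k hk i).2]))

lemma innerCube_mono {k l : ℕ} (h : k ≤ l) : innerCube d k ⊆ innerCube d l := fun x hx i => by
  have h1 : 1 / ((l : ℝ) + 2) ≤ 1 / ((k : ℝ) + 2) := by gcongr
  exact ⟨h1.trans (hx i).1, (hx i).2.trans (by linarith)⟩

/-- Consequently all late cutoffs equal `1` on the support of a given test field, so that their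
differences vanish there. -/
lemma exists_subset_innerCube {K : Set (EuclideanSpace ℝ (Fin d))} (hK : IsCompact K)
    (h : K ⊆ openCube d) : ∃ n, ∀ k ≥ n, K ⊆ innerCube d k := by
  obtain ⟨n, hn⟩ := hK.elim_directed_cover (fun k => interior (innerCube d k))
    (fun _ => isOpen_interior) (fun x hx => by
      obtain ⟨n, hn⟩ := eventually_mem_innerCube (h hx)
      exact Set.mem_iUnion.2 ⟨n, mem_interior_iff_mem_nhds.2 (hn n le_rfl)⟩)
    (monotone_nat_of_le_succ fun k => interior_mono (innerCube_mono k.le_succ)).directed_le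
  exact ⟨n, fun k hk => (hn.trans interior_subset).trans (innerCube_mono hk)⟩

lemma exists_cutoff (d k : ℕ) : ∃ χ : 𝓓(openCube d, ℝ),
    (∀ x, χ x ∈ Set.Icc (0 : ℝ) 1) ∧ ∀ x ∈ innerCube d k, χ x = 1 := by
  obtain ⟨f, h1, h2, h3, h4⟩ := exists_contMDiff_support_eq_eq_one_iff
    (modelWithCornersSelf ℝ (EuclideanSpace ℝ (Fin d)))
    (s := interior (innerCube d (k + 1))) (t := innerCube d k)
    isOpen_interior (isClosed_innerCube k) (fun x hx => by
      have hc : innerCube d (k + 1) ∈ 𝓝 x := by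
        rw [innerCube_eq_iInter]
        refine (iInter_mem).2 fun i => ?_
        have hc : Continuous fun x : EuclideanSpace ℝ (Fin d) => x i := by fun_prop
        have hlt : 1 / (((k + 1 : ℕ) : ℝ) + 2) < 1 / ((k : ℝ) + 2) := by
          push_cast
          gcongr
          linarith
        exact hc.continuousAt.preimage_mem_nhds
          (Icc_mem_nhds (hlt.trans_le (hx i).1) (lt_of_le_of_lt (hx i).2 (by linarith)))
      exact mem_interior_iff_mem_nhds.2 hc)
  have hs : tsupport f ⊆ innerCube d (k + 1) := by
    rw [tsupport, h3]
    exact (isClosed_innerCube _).closure_subset_iff.2 interior_subset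
  exact ⟨⟨f, h1.contDiff, (isCompact_innerCube (k + 1)).of_isClosed_subset
    (isClosed_tsupport _) hs, hs.trans (innerCube_subset _)⟩,
    fun x => h2 ⟨x, rfl⟩, fun x hx => (h4 x).1 hx⟩

/-- Smooth cutoff functions that increase to the indicator of the open cube. -/
def cutoff (d k : ℕ) : 𝓓(openCube d, ℝ) := (exists_cutoff d k).choose

lemma cutoff_mem_Icc (k : ℕ) (x : EuclideanSpace ℝ (Fin d)) :
    cutoff d k x ∈ Set.Icc (0 : ℝ) 1 := (exists_cutoff d k).choose_spec.1 x

lemma cutoff_eq_one {k : ℕ} {x : EuclideanSpace ℝ (Fin d)} (hx : x ∈ innerCube d k) :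
    cutoff d k x = 1 := (exists_cutoff d k).choose_spec.2 x hx

lemma tendsto_cutoff {x : EuclideanSpace ℝ (Fin d)} (hx : x ∈ openCube d) :
    Tendsto (fun k => cutoff d k x) atTop (𝓝 1) := by
  obtain ⟨n, hn⟩ := eventually_mem_innerCube hx
  refine tendsto_const_nhds.congr' ?_
  filter_upwards [eventually_ge_atTop n] with k hk
  exact (cutoff_eq_one (mem_of_mem_nhds (hn k hk))).symm

end Cutoff

/-! ### The spaces `C₀(Q₀; F)` and density of test functions. -/

section ContinuousFunctions

variable {d : ℕ} {F : Type*} [NormedAddCommGroup F] [NormedSpace ℝ F]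

lemma TestFunction.eq_zero (ψ : 𝓓(openCube d, F)) {x : EuclideanSpace ℝ (Fin d)}
    (hx : x ∉ openCube d) : ψ x = 0 :=
  image_eq_zero_of_notMem_tsupport fun h => hx (ψ.tsupport_subset h)

variable (d F) in
/-- The space `C₀(Q₀; F)` with the supremum norm. -/
def C0 : Submodule ℝ (EuclideanSpace ℝ (Fin d) →ᵇ F) where
  carrier := {f | ∀ x, x ∉ openCube d → f x = 0}
  add_mem' hf hg x hx := by simp [hf x hx, hg x hx]
  zero_mem' x _ := rfl
  smul_mem' c f hf x hx := by simp [hf x hx]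

lemma isClosed_C0 : IsClosed (C0 d F : Set (EuclideanSpace ℝ (Fin d) →ᵇ F)) := by
  have : (C0 d F : Set (EuclideanSpace ℝ (Fin d) →ᵇ F)) =
      ⋂ x, ⋂ (_ : x ∉ openCube d), {f | f x = 0} := by
    ext f; simp only [Set.mem_iInter]; rfl
  rw [this]
  exact isClosed_iInter fun x => isClosed_iInter fun _ =>
    isClosed_eq (BoundedContinuousFunction.evalCLM ℝ x).continuous continuous_const

instance [CompleteSpace F] : CompleteSpace (C0 d F) := isClosed_C0.completeSpace_coe

namespace C0

instance : CoeFun (C0 d F) fun _ => EuclideanSpace ℝ (Fin d) → F := ⟨fun f => f.1⟩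

lemma eq_zero (f : C0 d F) {x : EuclideanSpace ℝ (Fin d)} (hx : x ∉ openCube d) : f x = 0 :=
  f.2 x hx

lemma isC0 (f : C0 d F) : IsC0 f := ⟨f.1.continuous, f.2⟩

lemma norm_apply_le (f : C0 d F) (x : EuclideanSpace ℝ (Fin d)) : ‖f x‖ ≤ ‖f‖ :=
  f.1.norm_coe_le_norm x

lemma norm_le {f : C0 d F} {C : ℝ} (hC : 0 ≤ C) : ‖f‖ ≤ C ↔ ∀ x, ‖f x‖ ≤ C :=
  BoundedContinuousFunction.norm_le hC

lemma hasCompactSupport (f : C0 d F) : HasCompactSupport f :=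
  HasCompactSupport.intro isCompact_unitCube fun _ hx =>
    C0.eq_zero f fun h => hx (openCube_subset_unitCube h)

end C0

lemma IsC0.exists_C0 {φ : EuclideanSpace ℝ (Fin d) → F} (h : IsC0 φ) :
    ∃ f : C0 d F, ∀ x, f x = φ x := by
  have hs : HasCompactSupport φ := HasCompactSupport.intro isCompact_unitCube fun x hx =>
    h.2 x fun h' => hx (openCube_subset_unitCube h')
  obtain ⟨C, hC⟩ := hs.exists_bound_of_continuous h.1
  exact ⟨⟨BoundedContinuousFunction.ofNormedAddCommGroup φ h.1 C hC, h.2⟩, fun _ => rfl⟩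

/-- Test functions as elements of `C₀(Q₀; F)`. -/
def testToC0 : 𝓓(openCube d, F) →ₗ[ℝ] C0 d F where
  toFun ψ := ⟨BoundedContinuousFunction.ofNormedAddCommGroup ψ ψ.continuous
    (ψ.hasCompactSupport.exists_bound_of_continuous ψ.continuous).choose
    (ψ.hasCompactSupport.exists_bound_of_continuous ψ.continuous).choose_spec,
    fun _ hx => ψ.eq_zero hx⟩
  map_add' _ _ := by ext; rfl
  map_smul' _ _ := by ext; rfl

@[simp] lemma testToC0_apply (ψ : 𝓓(openCube d, F)) (x : EuclideanSpace ℝ (Fin d)) :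
    testToC0 ψ x = ψ x := rfl

lemma denseRange_testToC0 [CompleteSpace F] :
    DenseRange (testToC0 : 𝓓(openCube d, F) →ₗ[ℝ] C0 d F) := by
  refine Metric.denseRange_iff.2 fun f r hr => ?_
  -- A smooth selection `g` of these convex sets is `r / 2`-close to `f` and vanishes where `‖f‖ ≤ r
  -- / 8`, so its support is compact in the open cube. The local constants are `0` where `‖f x‖ < r
  -- / 4` and `f x` elsewhere; the gap between `r / 8` and `r / 4` lets both work on a
  -- neighbourhood.
  let t : EuclideanSpace ℝ (Fin d) → Set F := fun y =>
    {z | ‖z - f y‖ < r / 2 ∧ (‖f y‖ ≤ r / 8 → z = 0)}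
  have hconv : ∀ y, Convex ℝ (t y) := fun y => by
    have h1 : Convex ℝ {z | ‖z - f y‖ < r / 2} := by
      simpa only [Metric.ball, dist_eq_norm] using convex_ball (f y) (r / 2)
    have h2 : Convex ℝ {z : F | ‖f y‖ ≤ r / 8 → z = 0} := by
      by_cases h : ‖f y‖ ≤ r / 8
      · simp [h]
      · simp [h, convex_univ]
    exact h1.inter h2
  have hcont := f.1.continuous
  obtain ⟨g, hg⟩ := exists_contMDiffMap_forall_mem_convex_of_local_const
    (modelWithCornersSelf ℝ (EuclideanSpace ℝ (Fin d))) (n := (⊤ : ℕ∞)) hconv fun x => by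
      by_cases h : ‖f x‖ < r / 4
      · refine ⟨0, ?_⟩
        filter_upwards [(hcont.norm.continuousAt (x := x)).eventually_lt continuousAt_const h]
          with y hy
        exact ⟨by simpa using (by linarith : ‖f y‖ < r / 2), fun _ => rfl⟩
      · refine ⟨f x, ?_⟩
        have h' : r / 8 < ‖f x‖ := by linarith [not_lt.1 h]
        have hc2 : ContinuousAt (fun y => ‖f x - f y‖) x :=
          (continuous_const.sub hcont).norm.continuousAt
        filter_upwards [(hcont.norm.continuousAt (x := x)).eventually_const_lt h',
          hc2.eventually_lt_const (by simpa using hr : ‖f x - f x‖ < r / 2)] with y hy1 hy2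
        exact ⟨hy2, fun h => absurd hy1 (not_lt.2 h)⟩
  have hK : IsClosed {x | r / 8 ≤ ‖f x‖} := isClosed_le continuous_const hcont.norm
  have hKs : {x | r / 8 ≤ ‖f x‖} ⊆ openCube d := fun x hx => by
    by_contra h
    have : r / 8 ≤ ‖f x‖ := hx
    rw [C0.eq_zero f h, norm_zero] at this
    linarith
  have hs : tsupport g ⊆ {x | r / 8 ≤ ‖f x‖} := by
    refine closure_minimal (fun x hx => ?_) hK
    by_contra h
    exact hx ((hg x).2 (not_le.1 h).le)
  refine ⟨⟨g, g.contMDiff.contDiff, (isCompact_unitCube.of_isClosed_subset hK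
    (hKs.trans openCube_subset_unitCube)).of_isClosed_subset (isClosed_tsupport _) hs,
    hs.trans hKs⟩, ?_⟩
  rw [dist_comm, dist_eq_norm]
  refine lt_of_le_of_lt ((C0.norm_le (C := r / 2) (by linarith)).2 fun x => ?_) (by linarith)
  exact (hg x).1.le

end ContinuousFunctions

end
noncomputable section

/-! ### The isometric embedding of `L¹` into `C₀*`. -/

section Pairings

variable {d : ℕ}

lemma integral_norm_L1 (u : L1Cube d) : ∫ x in unitCube d, ‖u x‖ = ‖u‖ :=
  (L1.norm_eq_integral_norm u).symm

lemma C0.integrable_mul (φ : C0 d ℝ) (u : L1Cube d) :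
    Integrable (fun x => u x * φ x) (volume.restrict (unitCube d)) :=
  (C0.isC0 φ).integrable_mul u

lemma abs_integral_mul_le {φ : EuclideanSpace ℝ (Fin d) → ℝ} {C : ℝ} (u : L1Cube d)
    (hφ : ∀ x, |φ x| ≤ C) : |∫ x in unitCube d, u x * φ x| ≤ ‖u‖ * C := by
  rw [← integral_norm_L1, ← integral_mul_const, ← Real.norm_eq_abs]
  refine norm_integral_le_of_norm_le ((L1.integrable_coeFn u).norm.mul_const C)
    (Eventually.of_forall fun x => ?_)
  rw [norm_mul]
  exact mul_le_mul_of_nonneg_left (hφ x) (norm_nonneg _)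

variable (d) in
/-- The pairing `(u, φ) ↦ ∫ u φ` of `L¹(Q₀)` with `C₀(Q₀)`. -/
def integralPairing : L1Cube d →L[ℝ] StrongDual ℝ (C0 d ℝ) :=
  LinearMap.mkContinuous₂
    (LinearMap.mk₂ ℝ (fun (u : L1Cube d) (φ : C0 d ℝ) => ∫ x in unitCube d, u x * φ x)
      (fun u v φ => by
        rw [← integral_add (C0.integrable_mul φ u) (C0.integrable_mul φ v)]
        refine integral_congr_ae ?_
        filter_upwards [Lp.coeFn_add u v] with x hx
        rw [hx, Pi.add_apply, add_mul])
      (fun c u φ => by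
        rw [smul_eq_mul, ← integral_const_mul]
        refine integral_congr_ae ?_
        filter_upwards [Lp.coeFn_smul c u] with x hx
        rw [hx, Pi.smul_apply, smul_eq_mul, mul_assoc])
      (fun u φ χ => by
        rw [← integral_add (C0.integrable_mul φ u) (C0.integrable_mul χ u)]
        refine integral_congr_ae (Eventually.of_forall fun x => ?_)
        exact mul_add _ _ _)
      (fun c u φ => by
        rw [smul_eq_mul, ← integral_const_mul]
        refine integral_congr_ae (Eventually.of_forall fun x => ?_)
        exact mul_left_comm _ _ _)) 1 (fun u φ => by
    rw [one_mul]
    exact abs_integral_mul_le u (C0.norm_apply_le φ))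

@[simp] lemma integralPairing_apply (u : L1Cube d) (φ : C0 d ℝ) :
    integralPairing d u φ = ∫ x in unitCube d, u x * φ x := rfl

lemma abs_integralPairing_le (u : L1Cube d) (φ : C0 d ℝ) :
    |integralPairing d u φ| ≤ ‖u‖ * ‖φ‖ := abs_integral_mul_le u (C0.norm_apply_le φ)

/-- The sign of `u` is replaced by a smoothed sign of a continuous approximation, then cut off near
the boundary. -/
lemma exists_integral_mul_gt (u : L1Cube d) {ε : ℝ} (hε : 0 < ε) :
    ∃ φ : C0 d ℝ, ‖φ‖ ≤ 1 ∧ ‖u‖ - ε < integralPairing d u φ := by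
  obtain ⟨g, -, hg1, hg2, hgi⟩ :=
    (L1.integrable_coeFn u).exists_hasCompactSupport_integral_sub_le
      (ε := ε / 4) (by linarith)
  have hpos : ∀ x, 0 < |g x| + ε / 4 := fun x => by positivity
  -- Smoothing the sign costs `ε / 4`, and replacing `u` by `g` costs twice `‖u - g‖₁ ≤ ε / 4`; the
  -- last quarter of `ε` is left for the cutoff.
  let σ : EuclideanSpace ℝ (Fin d) → ℝ := fun x => g x / (|g x| + ε / 4)
  have hσc : Continuous σ := hg2.div (by fun_prop) fun x => (hpos x).ne'
  have hσ1 : ∀ x, |σ x| ≤ 1 := fun x => by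
    simp only [σ]
    rw [abs_div, abs_of_pos (hpos x), div_le_one (hpos x)]
    linarith
  have hσg : ∀ x, |g x| - ε / 4 ≤ g x * σ x := fun x => by
    simp only [σ]
    rw [mul_div_assoc', le_div_iff₀ (hpos x), ← sq, ← sq_abs (g x)]
    nlinarith [sq_nonneg (ε / 4)]
  have hφ : ∀ k, ∃ φ : C0 d ℝ, ∀ x, φ x = cutoff d k x * σ x := fun k =>
    IsC0.exists_C0 ⟨(cutoff d k).continuous.mul hσc, fun x hx => by
      simp [TestFunction.eq_zero (cutoff d k) hx]⟩
  choose φ hφ using hφ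
  have hφ1 : ∀ k, ‖φ k‖ ≤ 1 := fun k => (C0.norm_le zero_le_one).2 fun x => by
    rw [hφ, norm_mul, Real.norm_eq_abs, Real.norm_eq_abs, abs_of_nonneg (cutoff_mem_Icc k x).1]
    exact mul_le_one₀ (cutoff_mem_Icc k x).2 (abs_nonneg _) (hσ1 x)
  have hlim : Tendsto (fun k => integralPairing d u (φ k)) atTop
      (𝓝 (∫ x in unitCube d, u x * σ x)) := by
    refine tendsto_integral_of_dominated_convergence (fun x => ‖u x‖)
      (fun k => (C0.integrable_mul (φ k) u).aestronglyMeasurable)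
      (L1.integrable_coeFn u).norm (fun k => Eventually.of_forall fun x => ?_) ?_
    · rw [norm_mul]
      exact mul_le_of_le_one_right (norm_nonneg _) ((C0.norm_apply_le _ _).trans (hφ1 k))
    · filter_upwards [ae_mem_openCube] with x hx
      simp only [hφ]
      simpa using ((tendsto_cutoff hx).mul_const (σ x)).const_mul (u x)
  have hui : Integrable (fun x => u x * σ x) (volume.restrict (unitCube d)) :=
    (L1.integrable_coeFn u).mul_bdd (c := 1) hσc.aestronglyMeasurable (Eventually.of_forall hσ1)
  have hdi : Integrable (fun x => ‖u x - g x‖) (volume.restrict (unitCube d)) :=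
    ((L1.integrable_coeFn u).sub hgi).norm
  have key : ‖u‖ - 3 * (ε / 4) ≤ ∫ x in unitCube d, u x * σ x := by
    have h1 : ∫ x in unitCube d, (‖u x‖ - 2 * ‖u x - g x‖ - ε / 4) ≤
        ∫ x in unitCube d, u x * σ x := by
      refine integral_mono (((L1.integrable_coeFn u).norm.sub (hdi.const_mul 2)).sub
        (integrable_const _)) hui fun x => ?_
      have e1 : ‖u x‖ ≤ |g x| + ‖u x - g x‖ := by
        have := abs_add_le (g x) (u x - g x)
        rw [add_sub_cancel] at this
        exact this
      have e2 : |(u x - g x) * σ x| ≤ ‖u x - g x‖ := by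
        rw [abs_mul]
        exact mul_le_of_le_one_right (abs_nonneg _) (hσ1 x)
      have e3 := hσg x
      have e4 := neg_abs_le ((u x - g x) * σ x)
      have e5 : u x * σ x = g x * σ x + (u x - g x) * σ x := by ring
      simp only
      linarith
    have h2 := integral_sub ((L1.integrable_coeFn u).norm.sub (hdi.const_mul 2))
      (integrable_const (ε / 4))
    simp only [Pi.sub_apply] at h2
    rw [h2, integral_sub (L1.integrable_coeFn u).norm (hdi.const_mul 2), integral_const_mul,
      integral_norm_L1, integral_const] at h1
    simp only [probReal_univ, one_smul] at h1
    linarith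
  obtain ⟨k, hk⟩ := (hlim.eventually_const_lt (by linarith : ‖u‖ - ε < _)).exists
  exact ⟨φ k, hφ1 k, hk⟩

lemma norm_integralPairing (u : L1Cube d) : ‖integralPairing d u‖ = ‖u‖ := by
  refine le_antisymm (ContinuousLinearMap.opNorm_le_bound _ (norm_nonneg _)
    (abs_integralPairing_le u)) (le_of_forall_pos_le_add fun ε hε => ?_)
  obtain ⟨φ, h1, h2⟩ := exists_integral_mul_gt u hε
  have h3 := (integralPairing d u).le_opNorm φ
  have h4 := le_abs_self (integralPairing d u φ)
  have h5 := mul_le_of_le_one_right (norm_nonneg (integralPairing d u)) h1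
  rw [Real.norm_eq_abs] at h3
  linarith

lemma isometry_integralPairing : Isometry (integralPairing d) :=
  AddMonoidHomClass.isometry_of_norm _ norm_integralPairing

lemma isClosed_range_integralPairing : IsClosed (Set.range (integralPairing d)) :=
  isometry_integralPairing.isClosedEmbedding.isClosed_range

end Pairings

/-! ### The operator `div` and the map onto `W(Q₀)`. -/

section Divergence

variable {d : ℕ}

lemma divPairing_le_variation (u : BV d) {ψ : TestField d} (hψ : ∀ x, ‖ψ x‖ ≤ 1) :
    divPairing (BV.toL1 u) ψ ≤ (variation (BV.toL1 u)).toReal :=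
  (ENNReal.ofReal_le_iff_le_toReal (BV.variation_lt_top u).ne).1
    (le_iSup₂ (f := fun (ψ : TestField d) (_ : ∀ x, ‖ψ x‖ ≤ 1) =>
      ENNReal.ofReal (divPairing (BV.toL1 u) ψ)) ψ hψ)

lemma divPairing_le (u : BV d) (ψ : TestField d) :
    divPairing (BV.toL1 u) ψ ≤ (variation (BV.toL1 u)).toReal * ‖testToC0 ψ‖ := by
  refine le_of_forall_pos_le_add fun ε hε => ?_
  set V := (variation (BV.toL1 u)).toReal
  have hV : 0 ≤ V := ENNReal.toReal_nonneg
  -- The extra term makes `c` positive even for `ψ = 0`, and `V + 1` avoids a division by zero.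
  set c := ‖testToC0 ψ‖ + ε / (V + 1) with hc
  have hc0 : 0 < c := by positivity
  have h := divPairing_le_variation u (ψ := c⁻¹ • ψ) fun x => by
    have hx : ‖ψ x‖ ≤ c := (C0.norm_apply_le (testToC0 ψ) x).trans (by
      rw [hc]; linarith [show 0 < ε / (V + 1) by positivity])
    change ‖c⁻¹ • ψ x‖ ≤ 1
    rw [norm_smul, norm_inv, Real.norm_eq_abs, abs_of_pos hc0, inv_mul_le_one₀ hc0]
    exact hx
  rw [divPairing_smul_right, inv_mul_le_iff₀ hc0] at h
  refine h.trans ?_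
  rw [hc, add_mul, mul_comm]
  gcongr
  rw [div_mul_eq_mul_div, div_le_iff₀ (by positivity)]
  change ε * V ≤ ε * (V + 1)
  nlinarith

lemma abs_divPairing_le (u : BV d) (ψ : TestField d) :
    |divPairing (BV.toL1 u) ψ| ≤ (variation (BV.toL1 u)).toReal * ‖testToC0 ψ‖ := by
  refine abs_le.2 ⟨?_, divPairing_le u ψ⟩
  have h := divPairing_le u ((-1 : ℝ) • ψ)
  rw [divPairing_smul_right, map_smul, norm_smul] at h
  simp only [norm_neg, norm_one, one_mul] at h
  linarith

lemma variation_le_norm (u : BV d) : (variation (BV.toL1 u)).toReal ≤ ‖u‖ := by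
  rw [BV.norm_def]; linarith [norm_nonneg (BV.toL1 u)]

lemma norm_toL1_le (u : BV d) : ‖BV.toL1 u‖ ≤ ‖u‖ := by
  rw [BV.norm_def]; linarith [ENNReal.toReal_nonneg (a := variation (BV.toL1 u))]

/-- The inclusion of `BV(Q₀)` into `L¹(Q₀)` as a bounded operator. -/
def BV.toL1CLM : BV d →L[ℝ] L1Cube d :=
  BV.toL1.mkContinuous 1 fun u => by rw [one_mul]; exact norm_toL1_le u

@[simp] lemma BV.toL1CLM_apply (u : BV d) : BV.toL1CLM u = BV.toL1 u := rfl

lemma norm_divPairing_le (ψ : TestField d) (u : BV d) :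
    ‖divPairing (BV.toL1 u) ψ‖ ≤ ‖testToC0 ψ‖ * ‖u‖ := by
  refine (abs_divPairing_le u ψ).trans ?_
  rw [mul_comm]
  gcongr
  exact variation_le_norm u

variable (d) in
/-- The functionals `u ↦ ∫ u div ψ` for test fields `ψ`. -/
def divTest : TestField d →ₗ[ℝ] StrongDual ℝ (BV d) where
  toFun ψ := LinearMap.mkContinuous
    { toFun := fun u => divPairing (BV.toL1 u) ψ
      map_add' := fun u v => by rw [map_add, divPairing_add_left]
      map_smul' := fun c u => by rw [map_smul, divPairing_smul_left]; rfl }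
    ‖testToC0 ψ‖ (norm_divPairing_le ψ)
  map_add' ψ χ := by ext u; exact divPairing_add_right _ _ _
  map_smul' c ψ := by ext u; exact divPairing_smul_right _ _ _

@[simp] lemma divTest_apply (ψ : TestField d) (u : BV d) :
    divTest d ψ u = divPairing (BV.toL1 u) ψ := rfl

lemma norm_divTest_le (ψ : TestField d) : ‖divTest d ψ‖ ≤ 1 * ‖testToC0 ψ‖ := by
  rw [one_mul]
  exact LinearMap.mkContinuous_norm_le _ (norm_nonneg _) (norm_divPairing_le ψ)

variable (d) in
/-- The operator `div` from `C₀(Q₀; ℝ^d)` to `BV(Q₀)*`. -/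
def divC0 : C0 d (EuclideanSpace ℝ (Fin d)) →L[ℝ] StrongDual ℝ (BV d) :=
  (divTest d).extendOfNorm testToC0

@[simp] lemma divC0_testToC0 (ψ : TestField d) : divC0 d (testToC0 ψ) = divTest d ψ :=
  LinearMap.extendOfNorm_eq denseRange_testToC0 ⟨1, norm_divTest_le⟩ ψ

/-- Keeping `V[u]` instead of the full norm is essential: it gives the sharp bound on `toDualBV` and
later controls boundary layers. -/
lemma abs_divC0_le (ϕ : C0 d (EuclideanSpace ℝ (Fin d))) (u : BV d) :
    |divC0 d ϕ u| ≤ (variation (BV.toL1 u)).toReal * ‖ϕ‖ := by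
  refine denseRange_testToC0.induction_on (p := fun ϕ =>
    |divC0 d ϕ u| ≤ (variation (BV.toL1 u)).toReal * ‖ϕ‖) ϕ ?_ fun ψ => ?_
  rotate_left
  · rw [divC0_testToC0]
    exact abs_divPairing_le u ψ
  · refine isClosed_le ?_ (by fun_prop)
    have : Continuous fun ϕ => divC0 d ϕ u := by fun_prop
    exact this.abs

lemma exists_tendsto_testToC0 {F : Type*} [NormedAddCommGroup F] [NormedSpace ℝ F]
    [CompleteSpace F] (ϕ : C0 d F) :
    ∃ ψ : ℕ → 𝓓(openCube d, F), Tendsto (fun k => testToC0 (ψ k)) atTop (𝓝 ϕ) := by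
  obtain ⟨x, hx, hlim⟩ := mem_closure_iff_seq_limit.1 (denseRange_testToC0 ϕ)
  choose ψ hψ using hx
  exact ⟨ψ, by simpa only [hψ] using hlim⟩

lemma isDiv_divC0 (ϕ : C0 d (EuclideanSpace ℝ (Fin d))) : IsDiv ϕ (divC0 d ϕ) := by
  obtain ⟨ψ, hψ⟩ := exists_tendsto_testToC0 ϕ
  refine ⟨ψ, Metric.tendstoUniformly_iff.2 fun ε hε => ?_, fun u => ?_⟩
  · filter_upwards [Metric.tendsto_nhds.1 hψ ε hε] with k hk x
    rw [dist_comm, dist_eq_norm]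
    rw [dist_eq_norm] at hk
    exact (C0.norm_apply_le (testToC0 (ψ k) - ϕ) x).trans_lt hk
  · have hc : Continuous fun ϕ => divC0 d ϕ u := by fun_prop
    exact ((hc.tendsto ϕ).comp hψ).congr fun k => by simp

lemma IsDiv.eq_divC0 {φ : EuclideanSpace ℝ (Fin d) → EuclideanSpace ℝ (Fin d)}
    {D : StrongDual ℝ (BV d)} (h : IsDiv φ D) (ϕ : C0 d (EuclideanSpace ℝ (Fin d)))
    (hϕ : ∀ x, ϕ x = φ x) : D = divC0 d ϕ := by
  obtain ⟨ψ, hψ, hD⟩ := h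
  have hlim : Tendsto (fun k => testToC0 (ψ k)) atTop (𝓝 ϕ) := by
    refine Metric.tendsto_nhds.2 fun ε hε => ?_
    filter_upwards [Metric.tendstoUniformly_iff.1 hψ (ε / 2) (by linarith)] with k hk
    rw [dist_eq_norm]
    refine lt_of_le_of_lt ((C0.norm_le (C := ε / 2) (by linarith)).2 fun x => ?_) (by linarith)
    have := hk x
    rw [dist_comm, dist_eq_norm, ← hϕ] at this
    exact this.le
  ext u
  have hc : Continuous fun ϕ => divC0 d ϕ u := by fun_prop
  exact tendsto_nhds_unique (hD u) (((hc.tendsto ϕ).comp hlim).congr fun k => by simp)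

variable (d) in
/-- The operator `(φ, ϕ) ↦ φ + div ϕ` with range `W(Q₀)`. -/
def toDualBV : C0 d ℝ × C0 d (EuclideanSpace ℝ (Fin d)) →L[ℝ] StrongDual ℝ (BV d) :=
  ((ContinuousLinearMap.precomp ℝ BV.toL1CLM).comp (integralPairing d).flip).coprod (divC0 d)

@[simp] lemma toDualBV_apply (x : C0 d ℝ × C0 d (EuclideanSpace ℝ (Fin d))) (u : BV d) :
    toDualBV d x u = integralPairing d (BV.toL1 u) x.1 + divC0 d x.2 u := rfl

/-- The maximum norm of the product is matched with the sum `‖u‖₁ + V[u]`, so no constant is lost.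
-/
lemma norm_toDualBV_le (x : C0 d ℝ × C0 d (EuclideanSpace ℝ (Fin d))) :
    ‖toDualBV d x‖ ≤ ‖x‖ := by
  refine ContinuousLinearMap.opNorm_le_bound _ (norm_nonneg _) fun u => ?_
  rw [toDualBV_apply, BV.norm_def, Real.norm_eq_abs, mul_comm, add_mul]
  refine (abs_add_le _ _).trans (add_le_add ((abs_integralPairing_le _ _).trans ?_)
    ((abs_divC0_le _ _).trans ?_))
  · gcongr; exact norm_fst_le x
  · gcongr; exact norm_snd_le x

lemma range_toDualBV : LinearMap.range (toDualBV d).toLinearMap = W d := by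
  ext f
  constructor
  · rintro ⟨x, rfl⟩
    exact ⟨x.1, x.2, divC0 d x.2, C0.isC0 _, C0.isC0 _, isDiv_divC0 _, fun u => rfl⟩
  · rintro ⟨φ, ϕ, D, hφ, hϕ, hD, hf⟩
    obtain ⟨φ', hφ'⟩ := hφ.exists_C0
    obtain ⟨ϕ', hϕ'⟩ := hϕ.exists_C0
    refine ⟨(φ', ϕ'), ?_⟩
    ext u
    rw [hf, hD.eq_divC0 ϕ' hϕ']
    simp [hφ']

lemma toDualBV_mem_W (x : C0 d ℝ × C0 d (EuclideanSpace ℝ (Fin d))) : toDualBV d x ∈ W d := by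
  rw [← range_toDualBV]; exact ⟨x, rfl⟩

lemma exists_test_gt (u : BV d) {ε : ℝ} (hε : 0 < ε) : ∃ (φ : C0 d ℝ) (ψ : TestField d),
    ‖φ‖ ≤ 1 ∧ (∀ x, ‖ψ x‖ ≤ 1) ∧
      ‖u‖ - ε < integralPairing d (BV.toL1 u) φ + divPairing (BV.toL1 u) ψ := by
  obtain ⟨φ, hφ, hφ2⟩ := exists_integral_mul_gt (BV.toL1 u) (half_pos hε)
  have hψ : ∃ ψ : TestField d, (∀ x, ‖ψ x‖ ≤ 1) ∧
      (variation (BV.toL1 u)).toReal - ε / 2 < divPairing (BV.toL1 u) ψ := by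
    by_contra! h
    -- The zero field gives this; it is needed because `ENNReal.ofReal` truncates negative numbers.
    have h0 : 0 ≤ (variation (BV.toL1 u)).toReal - ε / 2 := by
      have := h 0 fun x => by simp
      simpa [divPairing, divergence] using this
    have h1 : variation (BV.toL1 u) ≤
        ENNReal.ofReal ((variation (BV.toL1 u)).toReal - ε / 2) :=
      iSup₂_le fun ψ hψ => ENNReal.ofReal_le_ofReal (h ψ hψ)
    have h2 := ENNReal.toReal_le_of_le_ofReal h0 h1
    linarith
  obtain ⟨ψ, hψ, hψ2⟩ := hψ
  exact ⟨φ, ψ, hφ, hψ, by rw [BV.norm_def]; linarith⟩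
end Divergence

end
noncomputable section

/-! ### Dilations and their derivative in the parameter. -/

section Dilation

variable {d : ℕ}

/-- The composition of a bounded continuous function with the dilation `y ↦ y + t (y - p)`. -/
def dilate (p : EuclideanSpace ℝ (Fin d)) (t : ℝ) :
    (EuclideanSpace ℝ (Fin d) →ᵇ ℝ) →L[ℝ] (EuclideanSpace ℝ (Fin d) →ᵇ ℝ) :=
  LinearMap.mkContinuous
    { toFun := fun f => f.compContinuous ⟨fun y => y + t • (y - p), by fun_prop⟩
      map_add' := fun _ _ => rfl
      map_smul' := fun _ _ => rfl } 1 fun f => by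
    rw [one_mul]
    exact (BoundedContinuousFunction.norm_le (norm_nonneg _)).2 fun y => f.norm_coe_le_norm _

@[simp] lemma dilate_apply (p : EuclideanSpace ℝ (Fin d)) (t : ℝ)
    (f : EuclideanSpace ℝ (Fin d) →ᵇ ℝ) (y : EuclideanSpace ℝ (Fin d)) :
    dilate p t f y = f (y + t • (y - p)) := rfl

lemma norm_dilate_le (p : EuclideanSpace ℝ (Fin d)) (t : ℝ)
    (f : EuclideanSpace ℝ (Fin d) →ᵇ ℝ) : ‖dilate p t f‖ ≤ ‖f‖ :=
  (BoundedContinuousFunction.norm_le (norm_nonneg _)).2 fun _ => f.norm_coe_le_norm _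

@[simp] lemma dilate_zero (p : EuclideanSpace ℝ (Fin d)) (f : EuclideanSpace ℝ (Fin d) →ᵇ ℝ) :
    dilate p 0 f = f := by
  ext y; simp

lemma C0.dilate_eq_zero {p : EuclideanSpace ℝ (Fin d)} (hp : p ∈ openCube d) {t : ℝ} (ht : 0 ≤ t)
    (f : C0 d ℝ) {y : EuclideanSpace ℝ (Fin d)} (hy : y ∉ openCube d) : dilate p t f.1 y = 0 :=
  C0.eq_zero f fun h => hy (mem_openCube_of_dilation hp ht h)

/-- The dilation of a test function about a point of the open cube. -/
def TestFunction.dilate (φ : 𝓓(openCube d, ℝ)) {p : EuclideanSpace ℝ (Fin d)}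
    (hp : p ∈ openCube d) {t : ℝ} (ht : 0 ≤ t) : 𝓓(openCube d, ℝ) where
  toFun y := φ (y + t • (y - p))
  contDiff' := φ.contDiff.comp (by fun_prop)
  hasCompactSupport' := by
    refine HasCompactSupport.intro isCompact_unitCube fun x hx => φ.eq_zero fun h => hx ?_
    exact openCube_subset_unitCube (mem_openCube_of_dilation hp ht h)
  tsupport_subset' := by
    intro y hy
    have hc : Continuous fun y : EuclideanSpace ℝ (Fin d) => y + t • (y - p) := by fun_prop
    have := closure_minimal (s := Function.support fun y => φ (y + t • (y - p)))
      (t := (fun y : EuclideanSpace ℝ (Fin d) => y + t • (y - p)) ⁻¹' tsupport φ)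
      (fun x hx => subset_closure hx) ((isClosed_tsupport φ).preimage hc) hy
    exact mem_openCube_of_dilation hp ht (φ.tsupport_subset this)

@[simp] lemma TestFunction.dilate_apply (φ : 𝓓(openCube d, ℝ)) {p : EuclideanSpace ℝ (Fin d)}
    (hp : p ∈ openCube d) {t : ℝ} (ht : 0 ≤ t) (y : EuclideanSpace ℝ (Fin d)) :
    φ.dilate hp ht y = φ (y + t • (y - p)) := rfl

/-- The product of a scalar test function with the field `y ↦ y - p`. -/
def TestFunction.radial (φ : 𝓓(openCube d, ℝ)) (p : EuclideanSpace ℝ (Fin d)) : TestField d where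
  toFun y := φ y • (y - p)
  contDiff' := φ.contDiff.smul (by fun_prop)
  hasCompactSupport' := φ.hasCompactSupport.smul_right
  tsupport_subset' := (closure_mono (Function.support_smul_subset_left _ _)).trans φ.tsupport_subset

@[simp] lemma TestFunction.radial_apply (φ : 𝓓(openCube d, ℝ)) (p y : EuclideanSpace ℝ (Fin d)) :
    φ.radial p y = φ y • (y - p) := rfl

/-- Solved for the radial derivative, this writes the velocity of a dilation as a divergence minus a
multiple of the function, both of which the functionals in question control. -/
lemma divergence_radial (φ : 𝓓(openCube d, ℝ)) (p y : EuclideanSpace ℝ (Fin d)) :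
    divergence (φ.radial p) y = d * φ y + fderiv ℝ φ y (y - p) := by
  have hφ : HasFDerivAt φ (fderiv ℝ φ y) y :=
    (φ.contDiff.differentiable (by simp)).differentiableAt.hasFDerivAt
  have h : HasFDerivAt (φ.radial p) _ y := hφ.smul ((hasFDerivAt_id y).sub_const p)
  have hsum : y - p = ∑ i, (y - p) i • EuclideanSpace.single i (1 : ℝ) := by
    ext j
    simp [Finset.sum_apply, Pi.single_apply]
  unfold divergence
  rw [h.fderiv]
  conv_rhs => rw [hsum, map_sum]
  simp [Finset.sum_add_distrib, mul_comm]

lemma fderiv_dilate (φ : 𝓓(openCube d, ℝ)) {p : EuclideanSpace ℝ (Fin d)}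
    (hp : p ∈ openCube d) {t : ℝ} (ht : 0 ≤ t) (y v : EuclideanSpace ℝ (Fin d)) :
    fderiv ℝ (φ.dilate hp ht) y v = (1 + t) * fderiv ℝ φ (y + t • (y - p)) v := by
  have hφ : HasFDerivAt φ (fderiv ℝ φ (y + t • (y - p))) (y + t • (y - p)) :=
    (φ.contDiff.differentiable (by simp)).differentiableAt.hasFDerivAt
  have hT : HasFDerivAt (fun y : EuclideanSpace ℝ (Fin d) => y + t • (y - p))
      (ContinuousLinearMap.id ℝ _ + t • ContinuousLinearMap.id ℝ _) y :=
    (hasFDerivAt_id y).add (((hasFDerivAt_id y).sub_const p).const_smul t)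
  have h : HasFDerivAt (φ.dilate hp ht) _ y :=
    HasFDerivAt.comp (g := φ) (f := fun y => y + t • (y - p)) y hφ hT
  rw [h.fderiv]
  simp [add_mul]

/-- The derivative is globally Lipschitz because it is smooth with compact support. Uniformity in
`z` makes dilations differentiable in the supremum norm. -/
lemma exists_taylor_bound (φ : 𝓓(openCube d, ℝ)) : ∃ M : ℝ, 0 ≤ M ∧ ∀ z w,
    |φ (z + w) - φ z - fderiv ℝ φ z w| ≤ M * ‖w‖ ^ 2 := by
  obtain ⟨C, hC⟩ := (φ.contDiff.fderiv_right (m := 1) (by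
    norm_cast)).lipschitzWith_of_hasCompactSupport (φ.hasCompactSupport.fderiv ℝ) (by simp)
  refine ⟨C, C.2, fun z w => ?_⟩
  have h := (convex_closedBall z ‖w‖).norm_image_sub_le_of_norm_fderiv_le' (𝕜 := ℝ) (f := φ)
    (φ := fderiv ℝ φ z) (C := C * ‖w‖) (x := z) (y := z + w)
    (fun x _ => (φ.contDiff.differentiable (by simp)).differentiableAt) (fun x hx => by
      rw [← dist_eq_norm]
      refine (hC.dist_le_mul x z).trans ?_
      gcongr
      exact hx) (by simp) (by simp)
  rw [add_sub_cancel_left, Real.norm_eq_abs] at h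
  linarith

lemma norm_sub_le_of_mem_openCube {y p : EuclideanSpace ℝ (Fin d)} (hy : y ∈ openCube d)
    (hp : p ∈ openCube d) : ‖y - p‖ ≤ 2 * √(d : ℝ) := by
  have h1 := norm_le_of_mem_unitCube (openCube_subset_unitCube hy)
  have h2 := norm_le_of_mem_unitCube (openCube_subset_unitCube hp)
  linarith [norm_sub_le y p]

lemma TestFunction.norm_radial_le (φ : 𝓓(openCube d, ℝ)) {p : EuclideanSpace ℝ (Fin d)}
    (hp : p ∈ openCube d) : ‖testToC0 (φ.radial p)‖ ≤ 2 * √(d : ℝ) * ‖testToC0 φ‖ := by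
  refine (C0.norm_le (by positivity)).2 fun y => ?_
  rw [testToC0_apply, radial_apply, norm_smul, mul_comm]
  by_cases hy : y ∈ openCube d
  · gcongr
    · exact norm_sub_le_of_mem_openCube hy hp
    · exact C0.norm_apply_le (testToC0 φ) y
  · rw [φ.eq_zero hy]
    simp only [norm_zero, mul_zero]
    positivity

lemma isC0_divergence (ψ : TestField d) : IsC0 (divergence ψ) := by
  refine ⟨continuous_divergence ψ, fun x hx => ?_⟩
  have h : fderiv ℝ ψ x = 0 :=
    image_eq_zero_of_notMem_tsupport fun h =>
      hx (ψ.tsupport_subset (tsupport_fderiv_subset ℝ h))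
  simp [divergence, h]

/-- The divergence of a test field as an element of `C₀(Q₀)`. -/
def testDivergence (ψ : TestField d) : C0 d ℝ := (isC0_divergence ψ).exists_C0.choose

@[simp] lemma testDivergence_apply (ψ : TestField d) (x : EuclideanSpace ℝ (Fin d)) :
    testDivergence ψ x = divergence ψ x := (isC0_divergence ψ).exists_C0.choose_spec x

/-- The derivative of `t ↦ φ (y + t (y - p))`, as a function of `y`. -/
def dilateDeriv (φ : 𝓓(openCube d, ℝ)) {p : EuclideanSpace ℝ (Fin d)}
    (hp : p ∈ openCube d) {t : ℝ} (ht : 0 ≤ t) : C0 d ℝ :=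
  (1 + t)⁻¹ • (testDivergence ((φ.dilate hp ht).radial p) - (d : ℝ) • testToC0 (φ.dilate hp ht))

lemma dilateDeriv_apply (φ : 𝓓(openCube d, ℝ)) {p : EuclideanSpace ℝ (Fin d)}
    (hp : p ∈ openCube d) {t : ℝ} (ht : 0 ≤ t) (y : EuclideanSpace ℝ (Fin d)) :
    dilateDeriv φ hp ht y = fderiv ℝ φ (y + t • (y - p)) (y - p) := by
  have h : dilateDeriv φ hp ht y = (1 + t)⁻¹ *
      (testDivergence ((φ.dilate hp ht).radial p) y - d * (φ.dilate hp ht y)) := rfl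
  rw [h, testDivergence_apply, divergence_radial, fderiv_dilate]
  have : 1 + t ≠ 0 := by positivity
  field_simp
  ring

lemma hasDerivWithinAt_dilate (φ : 𝓓(openCube d, ℝ)) {p : EuclideanSpace ℝ (Fin d)}
    (hp : p ∈ openCube d) {t : ℝ} (ht : 0 ≤ t) :
    HasDerivWithinAt (fun s => dilate p s (testToC0 φ).1) (dilateDeriv φ hp ht).1 (Set.Ici 0) t := by
  obtain ⟨M, hM, hT⟩ := exists_taylor_bound φ
  set R := 2 * √(d : ℝ) with hR
  have key : ∀ s ∈ Set.Ici (0 : ℝ), ‖dilate p s (testToC0 φ).1 - dilate p t (testToC0 φ).1 -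
      (s - t) • (dilateDeriv φ hp ht).1‖ ≤ M * R ^ 2 * (s - t) ^ 2 := fun s hs => by
    refine (BoundedContinuousFunction.norm_le (by positivity)).2 fun y => ?_
    by_cases hy : y ∈ openCube d
    · have h := hT (y + t • (y - p)) ((s - t) • (y - p))
      have e1 : y + t • (y - p) + (s - t) • (y - p) = y + s • (y - p) := by
        rw [add_assoc, ← add_smul]; congr 2; ring
      rw [e1, map_smul, norm_smul, mul_pow, Real.norm_eq_abs, sq_abs] at h
      have e2 : (dilate p s (testToC0 φ).1 - dilate p t (testToC0 φ).1 -
          (s - t) • (dilateDeriv φ hp ht).1) y = φ (y + s • (y - p)) - φ (y + t • (y - p)) -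
          (s - t) • fderiv ℝ φ (y + t • (y - p)) (y - p) := by
        rw [← dilateDeriv_apply φ hp ht]; rfl
      rw [e2, Real.norm_eq_abs]
      refine h.trans ?_
      have h3 : ‖y - p‖ ^ 2 ≤ R ^ 2 := by
        gcongr; exact norm_sub_le_of_mem_openCube hy hp
      nlinarith [mul_le_mul_of_nonneg_left h3 (mul_nonneg hM (sq_nonneg (s - t)))]
    · have e2 : (dilate p s (testToC0 φ).1 - dilate p t (testToC0 φ).1 -
          (s - t) • (dilateDeriv φ hp ht).1) y = dilate p s (testToC0 φ).1 y -
          dilate p t (testToC0 φ).1 y - (s - t) • dilateDeriv φ hp ht y := rfl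
      rw [e2, C0.dilate_eq_zero hp hs _ hy, C0.dilate_eq_zero hp ht _ hy,
        C0.eq_zero _ hy]
      simp only [smul_zero, sub_zero, norm_zero]
      positivity
  rw [hasDerivWithinAt_iff_isLittleO]
  refine Asymptotics.IsBigO.trans_isLittleO (g := fun s => (s - t) ^ 2) ?_ ?_
  · refine Asymptotics.IsBigO.of_bound (M * R ^ 2) ?_
    filter_upwards [self_mem_nhdsWithin] with s hs
    simpa using key s hs
  · have h := (Asymptotics.isLittleO_pow_id (𝕜 := ℝ) (one_lt_two)).comp_tendsto
      (k := fun s : ℝ => s - t) (l' := 𝓝[Set.Ici 0] t) (by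
        have : Continuous fun s : ℝ => s - t := by fun_prop
        simpa using (this.tendsto t).mono_left nhdsWithin_le_nhds)
    exact h

/-- Dilations move a functional that is bounded on divergences by at most a multiple of the
dilation parameter. -/
lemma abs_dilate_sub_le (Φ : (EuclideanSpace ℝ (Fin d) →ᵇ ℝ) →L[ℝ] ℝ) {C : ℝ} (hC : 0 ≤ C)
    (hΦ : ∀ ψ : TestField d, |Φ (testDivergence ψ).1| ≤ C * ‖testToC0 ψ‖)
    {p : EuclideanSpace ℝ (Fin d)} (hp : p ∈ openCube d) {t : ℝ} (ht : 0 ≤ t) (φ : C0 d ℝ) :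
    |Φ (dilate p t φ.1) - Φ φ.1| ≤ (C * (2 * √(d : ℝ)) + d * ‖Φ‖) * t * ‖φ‖ := by
  refine denseRange_testToC0.induction_on (p := fun φ : C0 d ℝ =>
    |Φ (dilate p t φ.1) - Φ φ.1| ≤ (C * (2 * √(d : ℝ)) + d * ‖Φ‖) * t * ‖φ‖) φ ?_ fun φ => ?_
  · exact isClosed_le (by fun_prop) (by fun_prop)
  have hder : ∀ s, ∀ hs : 0 ≤ s, HasDerivWithinAt (fun s => Φ (dilate p s (testToC0 φ).1))
      (Φ (dilateDeriv φ hp hs).1) (Set.Ici 0) s := fun s hs =>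
    Φ.hasFDerivAt.comp_hasDerivWithinAt s (hasDerivWithinAt_dilate φ hp hs)
  have hbound : ∀ s, ∀ hs : 0 ≤ s, |Φ (dilateDeriv φ hp hs).1| ≤
      (C * (2 * √(d : ℝ)) + d * ‖Φ‖) * ‖testToC0 φ‖ := fun s hs => by
    have hn : ‖testToC0 (φ.dilate hp hs)‖ ≤ ‖testToC0 φ‖ := norm_dilate_le p s (testToC0 φ).1
    have e : Φ (dilateDeriv φ hp hs).1 = (1 + s)⁻¹ *
        (Φ (testDivergence ((φ.dilate hp hs).radial p)).1 -
          d * Φ (testToC0 (φ.dilate hp hs)).1) := by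
      simp [dilateDeriv]
    have h1 := (hΦ ((φ.dilate hp hs).radial p)).trans
      (mul_le_mul_of_nonneg_left ((φ.dilate hp hs).norm_radial_le hp) hC)
    have h2 := (Φ.le_opNorm (testToC0 (φ.dilate hp hs)).1)
    rw [e, abs_mul, abs_of_nonneg (by positivity : 0 ≤ (1 + s)⁻¹)]
    refine (mul_le_of_le_one_left (abs_nonneg _) (inv_le_one_of_one_le₀ (by linarith))).trans ?_
    refine (abs_sub _ _).trans ?_
    rw [add_mul, abs_mul, Nat.abs_cast]
    refine add_le_add (h1.trans ?_) ?_
    · rw [← mul_assoc]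
      gcongr
    · rw [mul_assoc]
      gcongr
      refine h2.trans ?_
      gcongr
      exact hn
  have hex : ∀ s, ∃ v, 0 ≤ s →
      HasDerivWithinAt (fun s => Φ (dilate p s (testToC0 φ).1)) v (Set.Ici 0) s ∧
        ‖v‖ ≤ (C * (2 * √(d : ℝ)) + d * ‖Φ‖) * ‖testToC0 φ‖ := fun s => by
    by_cases hs : 0 ≤ s
    · exact ⟨_, fun _ => ⟨hder s hs, hbound s hs⟩⟩
    · exact ⟨0, fun h => absurd h hs⟩
  choose f' hf' using hex
  have h := norm_image_sub_le_of_norm_deriv_le_segment'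
    (f := fun s => Φ (dilate p s (testToC0 φ).1)) (a := 0) (b := t) (f' := f')
    (C := (C * (2 * √(d : ℝ)) + d * ‖Φ‖) * ‖testToC0 φ‖)
    (fun x hx => (hf' x hx.1).1.mono Set.Icc_subset_Ici_self) (fun x hx => (hf' x hx.1).2)
    t ⟨ht, le_rfl⟩
  simp only [dilate_zero, sub_zero, Real.norm_eq_abs] at h
  linarith

end Dilation

/-! ### Functionals bounded on divergences are `L¹` functions. -/

section Representation

variable {d : ℕ}

lemma continuous_dilate (f : C0 d ℝ) (t : ℝ) : Continuous fun p => dilate p t f.1 := by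
  have hu : UniformContinuous f :=
    (C0.hasCompactSupport f).uniformContinuous_of_continuous f.1.continuous
  refine Metric.continuous_iff.2 fun p ε hε => ?_
  obtain ⟨δ, hδ, h⟩ := Metric.uniformContinuous_iff.1 hu (ε / 2) (half_pos hε)
  refine ⟨δ / (|t| + 1), by positivity, fun q hq => ?_⟩
  rw [dist_eq_norm]
  refine lt_of_le_of_lt ((BoundedContinuousFunction.norm_le (half_pos hε).le).2 fun y => ?_)
    (half_lt_self hε)
  have h1 : dist (y + t • (y - q)) (y + t • (y - p)) < δ := by
    have e : y + t • (y - q) - (y + t • (y - p)) = t • (p - q) := by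
      rw [add_sub_add_left_eq_sub, ← smul_sub, sub_sub_sub_cancel_left]
    rw [dist_eq_norm, e, norm_smul, Real.norm_eq_abs, ← dist_eq_norm, dist_comm]
    rw [lt_div_iff₀ (by positivity)] at hq
    nlinarith [abs_nonneg t, dist_nonneg (x := q) (y := p)]
  have := (h h1).le
  rwa [dist_eq_norm] at this

lemma integrable_dilate (f : C0 d ℝ) (t : ℝ) :
    Integrable (fun p => dilate p t f.1) (volume.restrict (unitCube d)) := by
  refine Integrable.of_bound (continuous_dilate f t).aestronglyMeasurable ‖f.1‖
    (Eventually.of_forall fun p => norm_dilate_le p t f.1)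

lemma setIntegral_C0 (f : C0 d ℝ) : ∫ x in unitCube d, |f x| = ∫ x, |f x| :=
  setIntegral_eq_integral_of_forall_compl_eq_zero fun x hx => by
    rw [C0.eq_zero f fun h => hx (openCube_subset_unitCube h), abs_zero]

/-- The average of the dilations maps `L¹` to bounded functions. -/
lemma norm_integral_dilate_le (f : C0 d ℝ) {t : ℝ} (ht : 0 < t) :
    ‖∫ p in unitCube d, dilate p t f.1‖ ≤ (t ^ d)⁻¹ * ∫ x in unitCube d, |f x| := by
  have hint : Integrable (fun x => |f x|) volume :=
    (f.1.continuous.integrable_of_hasCompactSupport (C0.hasCompactSupport f)).abs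
  refine (BoundedContinuousFunction.norm_le (by positivity)).2 fun y => ?_
  have e1 : (∫ p in unitCube d, dilate p t f.1) y = ∫ p in unitCube d, dilate p t f.1 y :=
    ((BoundedContinuousFunction.evalCLM ℝ y).integral_comp_comm (integrable_dilate f t)).symm
  -- The substitution is in the centre `p`, not in `y`: it scales volume by `t ^ d`, and the result
  -- does not depend on `y`.
  have e2 : ∫ p, |f (y + t • (y - p))| = (t ^ d)⁻¹ * ∫ x, |f x| := by
    rw [integral_sub_left_eq_self (fun q => |f (y + t • q)|) volume y,
      Measure.integral_comp_smul volume (fun q => |f (y + q)|) t,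
      integral_add_left_eq_self (fun q => |f q|) y]
    simp [abs_of_pos ht]
  rw [e1, setIntegral_C0, ← e2]
  refine (norm_integral_le_integral_norm _).trans ?_
  refine setIntegral_le_integral ?_ (Eventually.of_forall fun p => abs_nonneg _)
  exact ((hint.comp_add_left y).comp_smul ht.ne').comp_sub_left y

/-- A functional that is bounded by the `L¹` norm is given by an integrable function. -/
lemma exists_integralPairing_of_le (F : C0 d ℝ →ₗ[ℝ] ℝ) {C : ℝ}
    (hF : ∀ f : C0 d ℝ, |F f| ≤ C * ∫ x in unitCube d, |f x|) :
    ∃ u : L1Cube d, ∀ f, integralPairing d u f = F f := by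
  set μ := (volume : Measure (EuclideanSpace ℝ (Fin d))).restrict (unitCube d) with hμ
  let e₀ : C0 d ℝ →ₗ[ℝ] Lp ℝ 2 μ :=
    (BoundedContinuousFunction.toLp (E := ℝ) 2 μ ℝ).toLinearMap ∘ₗ (C0 d ℝ).subtype
  have he₀ : ∀ f : C0 d ℝ, e₀ f =ᵐ[μ] f := fun f =>
    BoundedContinuousFunction.coeFn_toLp 2 μ ℝ f.1
  -- The cube has measure `1`, so an `L¹` bound is also an `L²` bound and Riesz representation
  -- applies. Using the closure `H` avoids showing that `C₀` is dense in `L²`.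
  let H : Submodule ℝ (Lp ℝ 2 μ) := (LinearMap.range e₀).topologicalClosure
  have : CompleteSpace H := (Submodule.isClosed_topologicalClosure _).completeSpace_coe
  let e : C0 d ℝ →ₗ[ℝ] H := e₀.codRestrict H fun f =>
    Submodule.le_topologicalClosure _ ⟨f, rfl⟩
  have hdense : DenseRange e := fun x => by
    rw [closure_subtype, ← Set.range_comp]
    exact x.2
  have hC : 0 ≤ |C| := abs_nonneg C
  have hle : ∀ f : C0 d ℝ, ∫ x, |f x| ∂μ ≤ ‖e f‖ := fun f => by
    have h1 : ∫ x, |f x| ∂μ = (eLpNorm f 1 μ).toReal := by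
      rw [eLpNorm_one_eq_lintegral_enorm]
      exact integral_norm_eq_lintegral_enorm f.1.continuous.aestronglyMeasurable
    have h2 : ‖e f‖ = (eLpNorm f 2 μ).toReal := by
      rw [← eLpNorm_congr_ae (he₀ f)]; rfl
    have h3 : eLpNorm f 2 μ ≠ ∞ := by
      rw [← eLpNorm_congr_ae (he₀ f)]
      exact Lp.eLpNorm_ne_top _
    rw [h1, h2]
    exact ENNReal.toReal_mono h3 (eLpNorm_le_eLpNorm_of_exponent_le one_le_two
      f.1.continuous.aestronglyMeasurable)
  have hFe : ∀ f : C0 d ℝ, ‖F f‖ ≤ |C| * ‖e f‖ := fun f => by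
    refine (hF f).trans ?_
    have h0 : 0 ≤ ∫ x, |f x| ∂μ := integral_nonneg fun x => abs_nonneg _
    exact mul_le_mul (le_abs_self C) (hle f) h0 hC
  let v : H := (InnerProductSpace.toDual ℝ H).symm (F.extendOfNorm e)
  have hv : ∀ f, inner ℝ v (e f) = F f := fun f => by
    rw [InnerProductSpace.toDual_symm_apply]
    exact LinearMap.extendOfNorm_eq hdense ⟨|C|, hFe⟩ f
  have hvi : Integrable v.1 μ := (Lp.memLp v.1).integrable one_le_two
  refine ⟨hvi.toL1 _, fun f => ?_⟩
  rw [← hv f, integralPairing_apply, Submodule.coe_inner, L2.inner_def]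
  refine integral_congr_ae ?_
  filter_upwards [hvi.coeFn_toL1, he₀ f] with x h1 h2
  have h3 : (e f).1 x = f x := h2
  rw [h1, h3]
  simp [mul_comm]

/-- Composing `Φ` with a dilation of parameter `t` about a point `p` changes it by at most `K t` in
norm. Averaging over `p` in the cube keeps this bound and produces a functional bounded by the `L¹`
norm, hence an `L¹` function. So `Φ` is a norm limit of `L¹` functions. Dilations expand about
interior points, so they preserve vanishing outside the cube. -/
theorem exists_integralPairing_eq (Φ : StrongDual ℝ (C0 d ℝ)) {C : ℝ} (hC : 0 ≤ C)
    (hΦ : ∀ ψ : TestField d, |Φ (testDivergence ψ)| ≤ C * ‖testToC0 ψ‖) :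
    ∃ u : L1Cube d, integralPairing d u = Φ := by
  -- Dilates and their Bochner average are formed among all bounded continuous functions, so `Φ` is
  -- extended to that space.
  obtain ⟨Ψ, hΨ, -⟩ := exists_extension_norm_eq (C0 d ℝ) Φ
  set K := C * (2 * √(d : ℝ)) + d * ‖Ψ‖ with hK
  have hK0 : 0 ≤ K := by positivity
  suffices Φ ∈ closure (Set.range (integralPairing d)) by
    rwa [isClosed_range_integralPairing.closure_eq] at this
  refine Metric.mem_closure_iff.2 fun ε hε => ?_
  set t := ε / 2 / (K + 1) with ht
  have ht0 : 0 < t := by positivity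
  let F : C0 d ℝ →ₗ[ℝ] ℝ :=
    { toFun := fun f => ∫ p in unitCube d, Ψ (dilate p t f.1)
      map_add' := fun f g => by
        rw [← integral_add (Ψ.integrable_comp (integrable_dilate f t))
          (Ψ.integrable_comp (integrable_dilate g t))]
        simp
      map_smul' := fun c f => by
        rw [RingHom.id_apply, smul_eq_mul, ← integral_const_mul]
        simp }
  obtain ⟨u, hu⟩ := exists_integralPairing_of_le F (C := ‖Ψ‖ * (t ^ d)⁻¹) fun f => by
    have e : F f = Ψ (∫ p in unitCube d, dilate p t f.1) :=
      Ψ.integral_comp_comm (integrable_dilate f t)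
    rw [e, mul_assoc]
    refine (Ψ.le_opNorm _).trans ?_
    gcongr
    exact norm_integral_dilate_le f ht0
  refine ⟨_, ⟨u, rfl⟩, ?_⟩
  rw [dist_comm, dist_eq_norm]
  refine lt_of_le_of_lt (ContinuousLinearMap.opNorm_le_bound _ (by positivity : 0 ≤ K * t)
    fun f => ?_) ?_
  · have e : (integralPairing d u - Φ) f =
        ∫ p in unitCube d, (Ψ (dilate p t f.1) - Ψ f.1) := by
      rw [integral_sub (Ψ.integrable_comp (integrable_dilate f t)) (integrable_const _),
        integral_const, probReal_univ, one_smul, hΨ, sub_apply, hu]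
      rfl
    rw [e]
    refine (norm_integral_le_of_norm_le_const (C := K * t * ‖f‖) ?_).trans ?_
    · filter_upwards [ae_mem_openCube] with p hp
      exact abs_dilate_sub_le Ψ hC (fun ψ => by rw [hΨ]; exact hΦ ψ) hp ht0.le f
    · rw [probReal_univ, mul_one]
  · rw [ht, mul_div_assoc', div_lt_iff₀ (by positivity)]
    nlinarith

end Representation

end
noncomputable section

/-! ### Isometric preduals and strong uniqueness in general. -/

section Preduality

variable {E : Type*} [NormedAddCommGroup E] [NormedSpace ℝ E]

@[simp] lemma dualityMap_apply (P : Submodule ℝ (StrongDual ℝ E)) (u : E) (f : P) :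
    dualityMap P u f = f.1 u := rfl

lemma isometry_dualityMap {P : Submodule ℝ (StrongDual ℝ E)}
    (h : ∀ u : E, ∀ ε > 0, ∃ f ∈ P, ‖f‖ ≤ 1 ∧ ‖u‖ - ε < f u) : Isometry (dualityMap P) := by
  let J : E →+ StrongDual ℝ P :=
    { toFun := dualityMap P
      map_zero' := by ext; simp
      map_add' := fun u v => by ext; simp }
  refine AddMonoidHomClass.isometry_of_norm J fun u => ?_
  change ‖dualityMap P u‖ = ‖u‖
  refine le_antisymm (ContinuousLinearMap.opNorm_le_bound _ (norm_nonneg _) fun f => ?_)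
    (le_of_forall_pos_le_add fun ε hε => ?_)
  · rw [mul_comm]; exact f.1.le_opNorm u
  · obtain ⟨f, hf, h1, h2⟩ := h u ε hε
    have h3 := (dualityMap P u).le_opNorm ⟨f, hf⟩
    have h4 := mul_le_of_le_one_right (norm_nonneg (dualityMap P u)) h1
    have h5 := le_abs_self (f u)
    have h6 : |f u| ≤ ‖dualityMap P u‖ := h3.trans h4
    linarith

/-- The isometric isomorphism of a space with the dual of an isometric predual. -/
def IsIsometricPredual.equiv {P : Submodule ℝ (StrongDual ℝ E)} (h : IsIsometricPredual P) :
    E ≃ₗᵢ[ℝ] StrongDual ℝ P :=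
  LinearIsometryEquiv.ofSurjective
    { toFun := dualityMap P
      map_add' := fun u v => by ext; simp
      map_smul' := fun c u => by ext; simp
      norm_map' := fun u => by
        have := h.2.1.dist_eq u 0
        have h0 : dualityMap P (0 : E) = 0 := by ext; simp
        simpa [h0] using this } h.2.2

lemma exists_dual_ne_zero {X : Type*} [NormedAddCommGroup X] [NormedSpace ℝ X]
    {P : Submodule ℝ X} (hP : IsClosed (P : Set X)) {x : X} (hx : x ∉ P) :
    ∃ F : StrongDual ℝ X, (∀ y ∈ P, F y = 0) ∧ F x ≠ 0 := by
  obtain ⟨F, c, h1, h2⟩ := geometric_hahn_banach_closed_point P.convex hP hx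
  have h0 : 0 < c := by simpa using h1 0 P.zero_mem
  have hz : ∀ y ∈ P, F y = 0 := fun y hy => by
    by_contra hne
    have := h1 ((c / F y) • y) (P.smul_mem _ hy)
    rw [map_smul, smul_eq_mul, div_mul_cancel₀ _ hne] at this
    exact lt_irrefl _ this
  exact ⟨F, hz, (h0.trans h2).ne'⟩

/-- If `Y` is a strongly unique predual of `E` then any two preduals `Y` and `Z` of `E` have the same
annihilator in `E**`. -/
lemma IsStronglyUniquePredual.annihilator_eq [Nontrivial E] {Y Z : Type*}
    [NormedAddCommGroup Y] [NormedSpace ℝ Y] [NormedAddCommGroup Z] [NormedSpace ℝ Z]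
    (hu : IsStronglyUniquePredual Y) (J : E ≃ₗᵢ[ℝ] StrongDual ℝ Y) (L : E ≃ₗᵢ[ℝ] StrongDual ℝ Z)
    (ι : Y →L[ℝ] StrongDual ℝ E) (κ : Z →L[ℝ] StrongDual ℝ E)
    (hι : ∀ y u, ι y u = J u y) (hκ : ∀ z u, κ z u = L u z) (F : StrongDual ℝ (StrongDual ℝ E)) :
    (∀ z, F (κ z) = 0) ↔ ∀ y, F (ι y) = 0 := by
  let J' : StrongDual ℝ Y →L[ℝ] E := J.symm.toContinuousLinearEquiv
  have hJ' : ∀ y, J' y = J.symm y := fun y => rfl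
  let J₁ : E →L[ℝ] StrongDual ℝ Y := J.toContinuousLinearEquiv
  have hJ₁ : ∀ y, J₁ y = J y := fun y => rfl
  let L' : StrongDual ℝ Z →L[ℝ] E := L.symm.toContinuousLinearEquiv
  have hL' : ∀ y, L' y = L.symm y := fun y => rfl
  -- `T` places `Z` inside `Y**` through the identification of `Y*` with `E`. Its transpose maps
  -- `Y***` to `Z*`, and returning through `E` to `Y*` gives a projection whose kernel is the
  -- annihilator of `T Z`.
  let T : Z →L[ℝ] StrongDual ℝ (StrongDual ℝ Y) := (ContinuousLinearMap.precomp ℝ J').comp κ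
  have hT : ∀ z y, T z y = L (J.symm y) z := fun z y => hκ z (J.symm y)
  have hTn : ∀ z, ‖T z‖ ≤ ‖z‖ := fun z => by
    refine ContinuousLinearMap.opNorm_le_bound _ (norm_nonneg _) fun y => ?_
    rw [hT, mul_comm]
    refine ((L (J.symm y)).le_opNorm _).trans_eq ?_
    rw [L.norm_map, J.symm.norm_map]
  let Tt : StrongDual ℝ (StrongDual ℝ (StrongDual ℝ Y)) →L[ℝ] StrongDual ℝ Z :=
    ContinuousLinearMap.precomp ℝ T
  have hTt : ∀ ξ z, Tt ξ z = ξ (T z) := fun ξ z => rfl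
  let π : StrongDual ℝ (StrongDual ℝ (StrongDual ℝ Y)) →L[ℝ] StrongDual ℝ Y :=
    J₁.comp (L'.comp Tt)
  have hπ : ∀ ξ, π ξ = J (L.symm (Tt ξ)) := fun ξ => rfl
  have hπid : ∀ y, π (inclusionInDoubleDual ℝ (StrongDual ℝ Y) y) = y := fun y => by
    have : Tt (inclusionInDoubleDual ℝ (StrongDual ℝ Y) y) = L (J.symm y) := by
      ext z
      exact hT z y
    rw [hπ, this, LinearIsometryEquiv.symm_apply_apply, LinearIsometryEquiv.apply_symm_apply]
  have hπ0 : ∀ ξ, π ξ = 0 ↔ ∀ z, ξ (T z) = 0 := fun ξ => by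
    rw [hπ, map_eq_zero_iff _ J.injective, map_eq_zero_iff _ L.symm.injective]
    constructor
    · intro h z
      rw [← hTt, h]; rfl
    · intro h
      ext z
      exact h z
  have hn : ‖π‖ = 1 := by
    refine le_antisymm (ContinuousLinearMap.opNorm_le_bound _ zero_le_one fun ξ => ?_) ?_
    · rw [hπ, J.norm_map, LinearIsometryEquiv.norm_map, one_mul]
      refine ContinuousLinearMap.opNorm_le_bound _ (norm_nonneg _) fun z => ?_
      rw [hTt]
      refine (ξ.le_opNorm _).trans ?_
      gcongr
      exact hTn z
    -- Nontriviality of `E` enters here: a projection onto the zero space would have norm `0`.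
    · obtain ⟨u, hu0⟩ := exists_ne (0 : E)
      have h1 := π.le_opNorm (inclusionInDoubleDual ℝ (StrongDual ℝ Y) (J u))
      have h2 := double_dual_bound ℝ (StrongDual ℝ Y) (J u)
      rw [hπid] at h1
      have h3 : 0 < ‖J u‖ := by rw [J.norm_map]; exact norm_pos_iff.2 hu0
      have h4 := mul_le_mul_of_nonneg_left h2 (norm_nonneg π)
      exact le_of_mul_le_mul_right (by linarith) h3
  have hcl : IsClosed {ξ : WeakDual ℝ (StrongDual ℝ (StrongDual ℝ Y)) |
      π (WeakDual.toStrongDual ξ) = 0} := by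
    have : {ξ : WeakDual ℝ (StrongDual ℝ (StrongDual ℝ Y)) | π (WeakDual.toStrongDual ξ) = 0} =
        ⋂ z, {ξ | ξ (T z) = 0} := by
      ext ξ
      simp only [Set.mem_iInter]
      exact hπ0 _
    rw [this]
    exact isClosed_iInter fun z => isClosed_eq (WeakDual.eval_continuous _) continuous_const
  -- `ξ` is `F` transported from `E**` to `Y***`. The constructed projection kills it exactly when
  -- `F` annihilates `Z`, the canonical one exactly when `F` annihilates `Y`.
  let ξ : StrongDual ℝ (StrongDual ℝ (StrongDual ℝ Y)) := F.comp (ContinuousLinearMap.precomp ℝ J₁)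
  have hξT : ∀ z, ξ (T z) = F (κ z) := fun z => by
    have : ContinuousLinearMap.precomp ℝ J₁ (T z) = κ z := by
      ext u
      change κ z (J.symm (J u)) = _
      rw [LinearIsometryEquiv.symm_apply_apply]
    rw [← this]; rfl
  have hξι : ∀ y, ξ (inclusionInDoubleDual ℝ Y y) = F (ι y) := fun y => by
    have : ContinuousLinearMap.precomp ℝ J₁ (inclusionInDoubleDual ℝ Y y) = ι y := by
      ext u
      exact (hι y u).symm
    rw [← this]; rfl
  have h := hπ0 ξ
  rw [hu π hπid hn hcl ξ] at h
  simp only [hξT] at h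
  rw [← h]
  constructor
  · intro h y
    rw [← hξι]
    exact DFunLike.congr_fun h y
  · intro h
    ext y
    exact (hξι y).trans (h y)

/-- A predual of a nontrivial space is not strongly unique if there is another one. -/
theorem not_isStronglyUniquePredual [Nontrivial E] {W P : Submodule ℝ (StrongDual ℝ E)}
    (hW : IsIsometricPredual W) (hP : IsIsometricPredual P) (hne : P ≠ W) :
    ¬ IsStronglyUniquePredual W := by
  intro hu
  have key := hu.annihilator_eq hW.equiv hP.equiv W.subtypeL P.subtypeL
    (fun _ _ => rfl) (fun _ _ => rfl)
  refine hne (le_antisymm (fun f hf => ?_) fun w hw => ?_)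
  · by_contra h
    obtain ⟨F, h1, h2⟩ := exists_dual_ne_zero hW.1 h
    exact h2 ((key F).2 (fun w => h1 w w.2) ⟨f, hf⟩)
  · by_contra h
    obtain ⟨F, h1, h2⟩ := exists_dual_ne_zero hP.1 h
    exact h2 ((key F).1 (fun w => h1 w w.2) ⟨w, hw⟩)

end Preduality

/-! ### `W(Q₀)` is an isometric predual. -/

section Canonical

variable {d : ℕ}

lemma toDualBV_testDivergence (ψ : TestField d) :
    toDualBV d (testDivergence ψ, -testToC0 ψ) = 0 := by
  ext u
  simp [divPairing]

/-- A functional on `C₀(Q₀) × C₀(Q₀; ℝ^d)` that vanishes on the kernel of `toDualBV` is given by a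
function of bounded variation. -/
theorem exists_BV_of_vanish (Λ : StrongDual ℝ (C0 d ℝ × C0 d (EuclideanSpace ℝ (Fin d))))
    (hΛ : ∀ x, toDualBV d x = 0 → Λ x = 0) : ∃ u : BV d, ∀ x, Λ x = toDualBV d x u := by
  -- The elements `(div ψ, -ψ)` of the kernel tie the two components together: the second bounds the
  -- first on divergences and, by density, is determined by it.
  have hdiv : ∀ ψ : TestField d, Λ (testDivergence ψ, 0) = Λ (0, testToC0 ψ) := fun ψ => by
    have h := hΛ _ (toDualBV_testDivergence ψ)
    have e : ((testDivergence ψ, -testToC0 ψ) :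
        C0 d ℝ × C0 d (EuclideanSpace ℝ (Fin d))) =
        (testDivergence ψ, 0) - (0, testToC0 ψ) := by simp
    rw [e, map_sub, sub_eq_zero] at h
    exact h
  have hbound : ∀ ψ : TestField d, |Λ (0, testToC0 ψ)| ≤ ‖Λ‖ * ‖testToC0 ψ‖ := fun ψ => by
    have h := Λ.le_opNorm (0, testToC0 ψ)
    rwa [Prod.norm_def, norm_zero, max_eq_right (norm_nonneg _)] at h
  obtain ⟨u, hu⟩ := exists_integralPairing_eq
    (Λ.comp (ContinuousLinearMap.inl ℝ (C0 d ℝ) (C0 d (EuclideanSpace ℝ (Fin d)))))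
    (norm_nonneg Λ) fun ψ => by
      rw [ContinuousLinearMap.comp_apply, ContinuousLinearMap.inl_apply, hdiv]
      exact hbound ψ
  have hu1 : ∀ φ, integralPairing d u φ = Λ (φ, 0) := fun φ => by rw [hu]; rfl
  have hu2 : ∀ ψ : TestField d, divPairing u ψ = Λ (0, testToC0 ψ) := fun ψ => by
    rw [← hdiv, ← hu1]
    simp [divPairing]
  have hV : variation u < ∞ := by
    refine lt_of_le_of_lt (iSup₂_le fun ψ hψ => ENNReal.ofReal_le_ofReal ?_)
      (ENNReal.ofReal_lt_top (r := ‖Λ‖))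
    rw [hu2]
    refine (le_abs_self _).trans ((hbound ψ).trans (mul_le_of_le_one_right (norm_nonneg _) ?_))
    exact (C0.norm_le zero_le_one).2 hψ
  let U : BV d := ⟨u, hV⟩
  refine ⟨U, fun x => ?_⟩
  have h2 : ∀ ϕ, Λ (0, ϕ) = divC0 d ϕ U := fun ϕ => by
    refine denseRange_testToC0.induction_on (p := fun ϕ => Λ (0, ϕ) = divC0 d ϕ U) ϕ ?_
      fun ψ => ?_
    · exact isClosed_eq (by fun_prop) (by fun_prop)
    · rw [← hu2, divC0_testToC0]; rfl
  have e : x = (x.1, 0) + (0, x.2) := by simp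
  rw [e, map_add, ← hu1, h2]
  simp
  rfl

/-- The map induced by `toDualBV` on the quotient by its kernel is bounded below by the quotient
norm. A norming functional of a class is evaluation at some `u` with `‖u‖ ≤ 1`, so the quotient norm
is at most the norm of the image. Completeness of the quotient then makes the range closed. -/
lemma isClosed_W : IsClosed (W d : Set (StrongDual ℝ (BV d))) := by
  let S := toDualBV d
  let K : Submodule ℝ (C0 d ℝ × C0 d (EuclideanSpace ℝ (Fin d))) := LinearMap.ker S.toLinearMap
  have hK : IsClosed (K : Set (C0 d ℝ × C0 d (EuclideanSpace ℝ (Fin d)))) := S.isClosed_ker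
  let Sbar : (_ ⧸ K) →L[ℝ] StrongDual ℝ (BV d) :=
    ⟨K.liftQ S.toLinearMap le_rfl, S.continuous.quotient_lift _⟩
  have hn : ∀ q, ‖q‖ ≤ ‖Sbar q‖ := fun q => by
    obtain ⟨g, hg1, hg2⟩ := exists_dual_vector'' ℝ q
    obtain ⟨x, rfl⟩ := K.mkQ_surjective q
    let Q : _ →L[ℝ] (_ ⧸ K) := ⟨K.mkQ, continuous_quotient_mk'⟩
    obtain ⟨u, hu⟩ := exists_BV_of_vanish (g.comp Q) fun x hx => by
      have : Q x = 0 := (Submodule.Quotient.mk_eq_zero K).2 hx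
      rw [ContinuousLinearMap.comp_apply, this, map_zero]
    have hu1 : ‖u‖ ≤ 1 := le_of_forall_pos_le_add fun ε hε => by
      obtain ⟨φ, ψ, h1, h2, h3⟩ := exists_test_gt u hε
      have h4 : g (Q (φ, testToC0 ψ)) ≤ 1 := by
        refine (le_abs_self _).trans ((g.le_opNorm _).trans (mul_le_one₀ hg1 (norm_nonneg _) ?_))
        refine (Submodule.Quotient.norm_mk_le K _).trans ?_
        exact max_le h1 ((C0.norm_le zero_le_one).2 h2)
      have h5 := hu (φ, testToC0 ψ)
      rw [ContinuousLinearMap.comp_apply, toDualBV_apply, divC0_testToC0, divTest_apply] at h5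
      linarith
    have h1 : ‖K.mkQ x‖ = toDualBV d x u := by
      rw [← hu x]
      exact_mod_cast hg2.symm
    rw [h1]
    refine (le_abs_self _).trans (((toDualBV d x).le_opNorm u).trans ?_)
    exact mul_le_of_le_one_right (norm_nonneg _) hu1
  have hanti : AntilipschitzWith 1 Sbar :=
    AddMonoidHomClass.antilipschitz_of_bound Sbar fun q => by simpa using hn q
  have hrange : Set.range Sbar = (W d : Set (StrongDual ℝ (BV d))) := by
    rw [← range_toDualBV]
    ext f
    constructor
    · rintro ⟨q, rfl⟩
      obtain ⟨x, rfl⟩ := K.mkQ_surjective q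
      exact ⟨x, rfl⟩
    · rintro ⟨x, rfl⟩
      exact ⟨K.mkQ x, rfl⟩
  rw [← hrange]
  exact hanti.isClosed_range Sbar.uniformContinuous

theorem isIsometricPredual_W : IsIsometricPredual (W d) := by
  refine ⟨isClosed_W, isometry_dualityMap fun u ε hε => ?_, fun ℓ => ?_⟩
  · obtain ⟨φ, ψ, h1, h2, h3⟩ := exists_test_gt u hε
    refine ⟨_, toDualBV_mem_W (φ, testToC0 ψ), (norm_toDualBV_le _).trans ?_, by simpa using h3⟩
    exact max_le h1 ((C0.norm_le zero_le_one).2 h2)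
  · obtain ⟨u, hu⟩ := exists_BV_of_vanish (ℓ.comp ((toDualBV d).codRestrict (W d) toDualBV_mem_W))
      fun x hx => by
        have : (toDualBV d).codRestrict (W d) toDualBV_mem_W x = 0 := Subtype.ext hx
        rw [ContinuousLinearMap.comp_apply, this, map_zero]
    refine ⟨u, ?_⟩
    ext ⟨f, hf⟩
    rw [← range_toDualBV] at hf
    obtain ⟨x, rfl⟩ := hf
    exact (hu x).symm

end Canonical

end
noncomputable section

/-! ### Continuously differentiable functions in `BV(Q₀)`. -/

section SmoothFunctions

variable {d : ℕ}

lemma integrable_restrict_unitCube {F : Type*} [NormedAddCommGroup F]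
    {f : EuclideanSpace ℝ (Fin d) → F} (hf : Continuous f) :
    Integrable f (volume.restrict (unitCube d)) :=
  hf.continuousOn.integrableOn_compact isCompact_unitCube

lemma continuous_fderiv_apply {u : EuclideanSpace ℝ (Fin d) → ℝ} (hu : ContDiff ℝ 1 u)
    {v : EuclideanSpace ℝ (Fin d) → EuclideanSpace ℝ (Fin d)} (hv : Continuous v) :
    Continuous fun x => fderiv ℝ u x (v x) :=
  (hu.continuous_fderiv one_ne_zero).clm_apply hv

/-- Integration by parts in each coordinate; the compact support of `ψ` inside the cube removes
boundary terms. -/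
lemma integral_mul_divergence {u : EuclideanSpace ℝ (Fin d) → ℝ} (hu : ContDiff ℝ 1 u)
    (ψ : TestField d) :
    ∫ x in unitCube d, u x * divergence ψ x = -∫ x in unitCube d, fderiv ℝ u x (ψ x) := by
  have h1 : ∫ x in unitCube d, u x * divergence ψ x = ∫ x, u x * divergence ψ x :=
    setIntegral_eq_integral_of_forall_compl_eq_zero fun x hx => by
      rw [(isC0_divergence ψ).2 x fun h => hx (openCube_subset_unitCube h), mul_zero]
  have h2 : ∫ x in unitCube d, fderiv ℝ u x (ψ x) = ∫ x, fderiv ℝ u x (ψ x) :=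
    setIntegral_eq_integral_of_forall_compl_eq_zero fun x hx => by
      rw [ψ.eq_zero fun h => hx (openCube_subset_unitCube h), map_zero]
  let e : Fin d → EuclideanSpace ℝ (Fin d) := fun i => EuclideanSpace.single i 1
  have hψd : ∀ x, HasFDerivAt ψ (fderiv ℝ ψ x) x := fun x =>
    (ψ.contDiff.differentiable (by simp)).differentiableAt.hasFDerivAt
  have hψi : ∀ i x, HasFDerivAt (fun x => ψ x i)
      ((EuclideanSpace.proj i : EuclideanSpace ℝ (Fin d) →L[ℝ] ℝ).comp (fderiv ℝ ψ x)) x :=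
    fun i x => (EuclideanSpace.proj i : EuclideanSpace ℝ (Fin d) →L[ℝ] ℝ).hasFDerivAt.comp x (hψd x)
  have hfd : ∀ i x, fderiv ℝ (fun x => ψ x i) x (e i) = fderiv ℝ ψ x (e i) i := fun i x => by
    rw [(hψi i x).fderiv]; rfl
  have hψc : ∀ i, Continuous fun x => ψ x i := fun i =>
    (EuclideanSpace.proj i : EuclideanSpace ℝ (Fin d) →L[ℝ] ℝ).continuous.comp ψ.continuous
  have hψ0 : ∀ i x, x ∉ openCube d → ψ x i = 0 := fun i x hx => by rw [ψ.eq_zero hx]; rfl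
  have hfd0 : ∀ i x, x ∉ openCube d → fderiv ℝ ψ x (e i) i = 0 := fun i x hx => by
    have h : fderiv ℝ ψ x = 0 :=
      image_eq_zero_of_notMem_tsupport fun h =>
        hx (ψ.tsupport_subset (tsupport_fderiv_subset ℝ h))
    rw [h]; rfl
  have hfdc : ∀ i, Continuous fun x => fderiv ℝ ψ x (e i) i := fun i =>
    (EuclideanSpace.proj i : EuclideanSpace ℝ (Fin d) →L[ℝ] ℝ).continuous.comp
      ((ψ.contDiff.continuous_fderiv (by simp)).clm_apply continuous_const)
  have hint : ∀ f : EuclideanSpace ℝ (Fin d) → ℝ, Continuous f → (∀ x, x ∉ openCube d → f x = 0) →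
      Integrable f volume := fun f hf h0 =>
    hf.integrable_of_hasCompactSupport (HasCompactSupport.intro isCompact_unitCube fun x hx =>
      h0 x fun h => hx (openCube_subset_unitCube h))
  have i1 : ∀ i, Integrable (fun x => u x * fderiv ℝ ψ x (e i) i) volume := fun i =>
    hint _ (hu.continuous.mul (hfdc i)) fun x hx => by rw [hfd0 i x hx, mul_zero]
  have i2 : ∀ i, Integrable (fun x => fderiv ℝ u x (e i) * ψ x i) volume := fun i =>
    hint _ ((continuous_fderiv_apply hu continuous_const).mul (hψc i)) fun x hx => by
      rw [hψ0 i x hx, mul_zero]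
  have hsum : ∀ x, fderiv ℝ u x (ψ x) = ∑ i, fderiv ℝ u x (e i) * ψ x i := fun x => by
    have : ψ x = ∑ i, ψ x i • e i := by
      ext j
      simp [e, Finset.sum_apply, Pi.single_apply]
    conv_lhs => rw [this, map_sum]
    simp [mul_comm]
  rw [h1, h2]
  simp only [hsum, divergence, Finset.mul_sum]
  rw [integral_finsetSum _ fun i _ => i1 i, integral_finsetSum _ fun i _ => i2 i,
    ← Finset.sum_neg_distrib]
  refine Finset.sum_congr rfl fun i _ => ?_
  have h := integral_mul_fderiv_eq_neg_fderiv_mul_of_integrable (μ := volume) (f := u)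
    (g := fun x => ψ x i) (v := e i) (i2 i) (by simpa only [hfd] using i1 i)
    (hint _ (hu.continuous.mul (hψc i)) fun x hx => by rw [hψ0 i x hx, mul_zero])
    (fun x _ => (hu.differentiable one_ne_zero).differentiableAt)
    (fun x _ => (hψi i x).differentiableAt)
  simpa only [hfd] using h

/-- A continuously differentiable function has bounded variation on the cube. -/
lemma exists_BV_of_contDiff {u : EuclideanSpace ℝ (Fin d) → ℝ} (hu : ContDiff ℝ 1 u) :
    ∃ U : BV d, BV.toL1 U =ᵐ[volume.restrict (unitCube d)] u ∧
      (∀ ψ, divPairing (BV.toL1 U) ψ = -∫ x in unitCube d, fderiv ℝ u x (ψ x)) ∧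
      (variation (BV.toL1 U)).toReal ≤ ∫ x in unitCube d, ‖fderiv ℝ u x‖ := by
  have hi := integrable_restrict_unitCube hu.continuous
  have hdi := (integrable_restrict_unitCube (hu.continuous_fderiv one_ne_zero)).norm
  have hpair : ∀ ψ, divPairing (hi.toL1 u) ψ = -∫ x in unitCube d, fderiv ℝ u x (ψ x) :=
    fun ψ => by
      rw [← integral_mul_divergence hu]
      refine integral_congr_ae ?_
      filter_upwards [hi.coeFn_toL1] with x hx
      rw [hx]
  have hV : variation (hi.toL1 u) ≤ ENNReal.ofReal (∫ x in unitCube d, ‖fderiv ℝ u x‖) :=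
    iSup₂_le fun ψ hψ => ENNReal.ofReal_le_ofReal <| by
      rw [hpair]
      refine (neg_le_abs _).trans ?_
      rw [← Real.norm_eq_abs]
      refine norm_integral_le_of_norm_le hdi (Eventually.of_forall fun x => ?_)
      exact ((fderiv ℝ u x).le_opNorm _).trans (mul_le_of_le_one_right (norm_nonneg _) (hψ x))
  exact ⟨⟨hi.toL1 u, hV.trans_lt ENNReal.ofReal_lt_top⟩, hi.coeFn_toL1, hpair,
    ENNReal.toReal_le_of_le_ofReal (integral_nonneg fun _ => norm_nonneg _) hV⟩

lemma norm_L1_eq {U : L1Cube d} {u : EuclideanSpace ℝ (Fin d) → ℝ}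
    (h : U =ᵐ[volume.restrict (unitCube d)] u) : ‖U‖ = ∫ x in unitCube d, |u x| := by
  rw [← integral_norm_L1]
  refine integral_congr_ae ?_
  filter_upwards [h] with x hx
  rw [hx, Real.norm_eq_abs]

lemma exists_BV_one (d : ℕ) : ∃ U : BV d, ‖BV.toL1 U‖ = 1 ∧
    ∀ ψ, divPairing (BV.toL1 U) ψ = 0 := by
  obtain ⟨U, h1, h2, -⟩ := exists_BV_of_contDiff (d := d) (u := fun _ => 1) contDiff_const
  exact ⟨U, by simp [norm_L1_eq h1], fun ψ => by simp [h2]⟩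

/-- The constant function `1`. -/
def BV.one (d : ℕ) : BV d := (exists_BV_one d).choose

lemma BV.norm_toL1_one : ‖BV.toL1 (BV.one d)‖ = 1 := (exists_BV_one d).choose_spec.1

lemma BV.divPairing_one (ψ : TestField d) : divPairing (BV.toL1 (BV.one d)) ψ = 0 :=
  (exists_BV_one d).choose_spec.2 ψ

instance : Nontrivial (BV d) := ⟨⟨BV.one d, 0, fun h => by
  have := BV.norm_toL1_one (d := d)
  rw [h, map_zero, norm_zero] at this
  exact zero_ne_one this⟩⟩

lemma divC0_one (ϕ : C0 d (EuclideanSpace ℝ (Fin d))) : divC0 d ϕ (BV.one d) = 0 := by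
  refine denseRange_testToC0.induction_on (p := fun ϕ => divC0 d ϕ (BV.one d) = 0) ϕ ?_ fun ψ => ?_
  · exact isClosed_eq (by fun_prop) continuous_const
  · rw [divC0_testToC0, divTest_apply, BV.divPairing_one]

end SmoothFunctions

/-! ### A functional concentrated at the boundary. -/

section BoundaryFlux

variable {d : ℕ}

/-- The cutoffs of the constant `i`-th unit field. -/
def cutoffField (i : Fin d) (k : ℕ) : TestField d where
  toFun x := cutoff d k x • EuclideanSpace.single i 1
  contDiff' := (cutoff d k).contDiff.smul contDiff_const
  hasCompactSupport' := (cutoff d k).hasCompactSupport.smul_right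
  tsupport_subset' :=
    (closure_mono (Function.support_smul_subset_left _ _)).trans (cutoff d k).tsupport_subset

@[simp] lemma cutoffField_apply (i : Fin d) (k : ℕ) (x : EuclideanSpace ℝ (Fin d)) :
    cutoffField i k x = cutoff d k x • EuclideanSpace.single i 1 := rfl

lemma norm_cutoffField_le (i : Fin d) (k : ℕ) (x : EuclideanSpace ℝ (Fin d)) :
    ‖cutoffField i k x‖ ≤ 1 := by
  simp [norm_smul, abs_of_nonneg (cutoff_mem_Icc k x).1, (cutoff_mem_Icc k x).2]

/-- The functionals `div (χₖ eᵢ)` lie in the dual unit ball. Weak-star compactness gives a limit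
along an ultrafilter for all `u` at once, without any trace theory. -/
lemma exists_boundaryFlux (i : Fin d) : ∃ j : StrongDual ℝ (BV d), ∀ u,
    Tendsto (fun k => divPairing (BV.toL1 u) (cutoffField i k)) (hyperfilter ℕ : Filter ℕ)
      (𝓝 (j u)) := by
  let f : ℕ → WeakDual ℝ (BV d) := fun k => StrongDual.toWeakDual (divTest d (cutoffField i k))
  have hf : ∀ k, f k ∈ WeakDual.toStrongDual ⁻¹' Metric.closedBall (0 : StrongDual ℝ (BV d)) 1 :=
    fun k => by
      rw [Set.mem_preimage, mem_closedBall_zero_iff]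
      refine (norm_divTest_le _).trans ?_
      rw [one_mul]
      exact (C0.norm_le zero_le_one).2 (norm_cutoffField_le i k)
  obtain ⟨j, -, hj⟩ := (WeakDual.isCompact_closedBall (0 : StrongDual ℝ (BV d)) 1
    ).ultrafilter_le_nhds ((hyperfilter ℕ).map f) (by
      rw [le_principal_iff]
      exact Filter.mem_map.2 (Eventually.of_forall hf))
  refine ⟨WeakDual.toStrongDual j, fun u => ?_⟩
  exact ((WeakDual.eval_continuous u).tendsto j).comp hj

/-- A limit of the functionals `u ↦ ∫ u ∂ᵢχ`, for cutoff functions `χ` that increase to the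
indicator of the open cube: the flux of `u` through the boundary in direction `i`. -/
def boundaryFlux (i : Fin d) : StrongDual ℝ (BV d) := (exists_boundaryFlux i).choose

lemma tendsto_boundaryFlux (i : Fin d) (u : BV d) :
    Tendsto (fun k => divPairing (BV.toL1 u) (cutoffField i k)) (hyperfilter ℕ : Filter ℕ)
      (𝓝 (boundaryFlux i u)) := (exists_boundaryFlux i).choose_spec u

lemma boundaryFlux_one (i : Fin d) : boundaryFlux i (BV.one d) = 0 :=
  tendsto_nhds_unique (tendsto_boundaryFlux i _)
    (by simp only [BV.divPairing_one]; exact tendsto_const_nhds)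

/-- The witness is a multiple of `exp (-r xᵢ)`, normalized so that its gradient has `L¹` norm `1`.
It decreases in direction `i`, so the flux picks up this full mass, while the `L¹` norm is smaller
by the factor `r`. -/
lemma exists_BV_boundaryLayer (i : Fin d) {r : ℝ} (hr : 0 < r) : ∃ w : BV d,
    ‖BV.toL1 w‖ = r⁻¹ ∧ (variation (BV.toL1 w)).toReal ≤ 1 ∧ boundaryFlux i w = 1 := by
  let g : EuclideanSpace ℝ (Fin d) → ℝ := fun x => r * Real.exp (-r * x i)
  have hgc : Continuous g := by fun_prop
  have hg0 : ∀ x, 0 < g x := fun x => by positivity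
  set I := ∫ x in unitCube d, g x with hI
  have hgi := integrable_restrict_unitCube hgc
  have hI0 : 0 < I := by
    rw [hI, integral_pos_iff_support_of_nonneg (fun x => (hg0 x).le) hgi]
    have : Function.support g = Set.univ := by
      ext x; simpa using (hg0 x).ne'
    rw [this]
    simp
  let u : EuclideanSpace ℝ (Fin d) → ℝ := fun x => I⁻¹ * Real.exp (-r * x i)
  have hu : ContDiff ℝ 1 u := by fun_prop
  have hfd : ∀ x v, fderiv ℝ u x v = -(I⁻¹ * g x * v i) := fun x v => by
    have h : HasFDerivAt (fun x : EuclideanSpace ℝ (Fin d) => -r * x i)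
        (-r • (EuclideanSpace.proj i : EuclideanSpace ℝ (Fin d) →L[ℝ] ℝ)) x :=
      (EuclideanSpace.proj i : EuclideanSpace ℝ (Fin d) →L[ℝ] ℝ).hasFDerivAt.const_mul (-r)
    have h2 : HasFDerivAt u _ x := h.exp.const_mul I⁻¹
    rw [h2.fderiv]
    simp [g]
    ring
  obtain ⟨w, h1, h2, h3⟩ := exists_BV_of_contDiff hu
  refine ⟨w, ?_, h3.trans ?_, ?_⟩
  · have e : ∀ x, |u x| = r⁻¹ * I⁻¹ * g x := fun x => by
      rw [abs_of_pos (by positivity)]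
      simp only [u, g]
      field_simp
    rw [norm_L1_eq h1]
    simp only [e]
    rw [integral_const_mul, ← hI, mul_assoc, inv_mul_cancel₀ hI0.ne', mul_one]
  · have e : ∀ x, ‖fderiv ℝ u x‖ ≤ I⁻¹ * g x := fun x => by
      refine ContinuousLinearMap.opNorm_le_bound _ (by have := hg0 x; positivity) fun v => ?_
      rw [hfd, norm_neg, norm_mul, Real.norm_of_nonneg (by have := hg0 x; positivity)]
      have := hg0 x
      gcongr
      exact PiLp.norm_apply_le v i
    calc ∫ x in unitCube d, ‖fderiv ℝ u x‖ ≤ ∫ x in unitCube d, I⁻¹ * g x :=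
          integral_mono (integrable_restrict_unitCube (hu.continuous_fderiv one_ne_zero)).norm
            (hgi.const_mul _) e
      _ = 1 := by rw [integral_const_mul, ← hI, inv_mul_cancel₀ hI0.ne']
  · refine tendsto_nhds_unique (tendsto_boundaryFlux i w)
      (Tendsto.mono_left ?_ Nat.hyperfilter_le_atTop)
    have e : ∀ k, divPairing (BV.toL1 w) (cutoffField i k) =
        ∫ x in unitCube d, I⁻¹ * g x * cutoff d k x := fun k => by
      rw [h2, ← integral_neg]
      simp [hfd]
    simp only [e]
    have e1 : (1 : ℝ) = ∫ x in unitCube d, I⁻¹ * g x := by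
      rw [integral_const_mul, ← hI, inv_mul_cancel₀ hI0.ne']
    rw [e1]
    refine tendsto_integral_of_dominated_convergence (fun x => I⁻¹ * g x)
      (fun k => ((continuous_const.mul hgc).mul (cutoff d k).continuous).aestronglyMeasurable)
      (hgi.const_mul _) (fun k => Eventually.of_forall fun x => ?_) ?_
    · have := hg0 x
      rw [norm_mul, Real.norm_of_nonneg (by positivity), Real.norm_of_nonneg (cutoff_mem_Icc k x).1]
      exact mul_le_of_le_one_right (by positivity) (cutoff_mem_Icc k x).2
    · filter_upwards [ae_mem_openCube] with x hx
      simpa using (tendsto_cutoff hx).const_mul (I⁻¹ * g x)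

/-- Up to a small divergence term, an element of `W` is integration against a `C₀` function, hence
small on boundary layers, where the flux is `1`. -/
lemma boundaryFlux_notMem_W (i : Fin d) : boundaryFlux i ∉ W d := by
  rw [← range_toDualBV]
  rintro ⟨⟨φ, ϕ⟩, hx⟩
  obtain ⟨ψ, hψ⟩ := Metric.denseRange_iff.1
    (denseRange_testToC0 (d := d) (F := EuclideanSpace ℝ (Fin d))) ϕ (1 / 4) (by norm_num)
  set M := ‖φ‖ + ‖testDivergence ψ‖ with hM
  have hM0 : 0 ≤ M := by positivity
  -- With this `r` the two integral terms total at most `1 / 2` and the remainder at most `1 / 4`,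
  -- which is less than the flux `1`.
  obtain ⟨w, h1, h2, h3⟩ := exists_BV_boundaryLayer i (r := 2 * (M + 1)) (by positivity)
  have e : boundaryFlux i w = integralPairing d (BV.toL1 w) φ +
      integralPairing d (BV.toL1 w) (testDivergence ψ) + divC0 d (ϕ - testToC0 ψ) w := by
    have hd : integralPairing d (BV.toL1 w) (testDivergence ψ) = divC0 d (testToC0 ψ) w := by
      simp [divPairing]
    rw [← hx, hd, map_sub]
    change toDualBV d (φ, ϕ) w = _
    rw [toDualBV_apply, sub_apply]
    ring
  have b1 := (le_abs_self _).trans (abs_integralPairing_le (BV.toL1 w) φ)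
  have b2 := (le_abs_self _).trans (abs_integralPairing_le (BV.toL1 w) (testDivergence ψ))
  have b3 := (le_abs_self _).trans (abs_divC0_le (ϕ - testToC0 ψ) w)
  rw [dist_eq_norm] at hψ
  have b4 : (variation (BV.toL1 w)).toReal * ‖ϕ - testToC0 ψ‖ ≤ 1 / 4 :=
    (mul_le_of_le_one_left (norm_nonneg _) h2).trans hψ.le
  have b5 : ‖BV.toL1 w‖ * M ≤ 1 / 2 := by
    rw [h1, inv_mul_le_iff₀ (by positivity)]
    linarith
  rw [hM, mul_add] at b5
  linarith

end BoundaryFlux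

/-! ### A predual different from `W(Q₀)`. -/

section SecondPredual

variable {d : ℕ}

/-- The operator `f ↦ f - f(1) j` of `BV(Q₀)*`, where `j` is the boundary flux. -/
def fluxShift (i : Fin d) : StrongDual ℝ (BV d) →L[ℝ] StrongDual ℝ (BV d) :=
  ContinuousLinearMap.id ℝ _ -
    (inclusionInDoubleDual ℝ (BV d) (BV.one d)).smulRight (boundaryFlux i)

lemma fluxShift_apply (i : Fin d) (f : StrongDual ℝ (BV d)) :
    fluxShift i f = f - f (BV.one d) • boundaryFlux i := rfl

/-- The predual `{f : f - f(1) j ∈ W(Q₀)}` of `BV(Q₀)`. -/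
def fluxPredual (i : Fin d) : Submodule ℝ (StrongDual ℝ (BV d)) :=
  (W d).comap (fluxShift i).toLinearMap

lemma mem_fluxPredual {i : Fin d} {f : StrongDual ℝ (BV d)} :
    f ∈ fluxPredual i ↔ f - f (BV.one d) • boundaryFlux i ∈ W d := Iff.rfl

lemma add_smul_boundaryFlux_mem (i : Fin d) {g : StrongDual ℝ (BV d)} (hg : g ∈ W d) :
    g + g (BV.one d) • boundaryFlux i ∈ fluxPredual i := by
  rw [mem_fluxPredual]
  simpa [boundaryFlux_one] using hg

/-- If the two agreed, an element `g` of `W` with `g(1) ≠ 0` would have `g + g(1) j` in `W` as well,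
hence `j ∈ W`. -/
lemma fluxPredual_ne_W (i : Fin d) : fluxPredual i ≠ W d := by
  intro h
  obtain ⟨φ, -, hφ⟩ := exists_integral_mul_gt (BV.toL1 (BV.one d)) (half_pos one_pos)
  rw [BV.norm_toL1_one] at hφ
  have hg := toDualBV_mem_W (d := d) (φ, 0)
  have hg1 : toDualBV d (φ, 0) (BV.one d) ≠ 0 := by
    rw [toDualBV_apply, divC0_one, add_zero]
    linarith
  have h2 := add_smul_boundaryFlux_mem i hg
  rw [h, Submodule.add_mem_iff_right _ hg, Submodule.smul_mem_iff _ hg1] at h2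
  exact boundaryFlux_notMem_W i h2

lemma norm_toDualBV_testToC0_le {φ : C0 d ℝ} {ψ : TestField d} (hφ : ‖φ‖ ≤ 1)
    (hψ : ∀ x, ‖ψ x‖ ≤ 1) : ‖toDualBV d (φ, testToC0 ψ)‖ ≤ 1 :=
  (norm_toDualBV_le _).trans (norm_prod_le_iff.2 ⟨hφ, (C0.norm_le zero_le_one).2 hψ⟩)

/-- A nearly norming `φ + div ψ` is corrected by `s (j - div (χₖ eᵢ))` with `s = ∫ φ`, which puts it
into the second predual. For large `k` along the ultrafilter, the correction is small at `u` and
does not raise the norm above `1`. -/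
lemma exists_fluxPredual_gt (i : Fin d) (u : BV d) {ε : ℝ} (hε : 0 < ε) :
    ∃ f ∈ fluxPredual i, ‖f‖ ≤ 1 ∧ ‖u‖ - ε < f u := by
  obtain ⟨φ, ψ, h1, h2, h3⟩ := exists_test_gt u (half_pos hε)
  set s := integralPairing d (BV.toL1 (BV.one d)) φ with hs
  have hs1 : |s| ≤ 1 := by
    refine (abs_integralPairing_le _ _).trans ?_
    rwa [BV.norm_toL1_one, one_mul]
  obtain ⟨n, hn⟩ := exists_subset_innerCube ψ.hasCompactSupport ψ.tsupport_subset
  have hev : ∀ᶠ k in (hyperfilter ℕ : Filter ℕ), n ≤ k :=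
    Nat.hyperfilter_le_atTop (eventually_ge_atTop n)
  have hclose : ∀ᶠ k in (hyperfilter ℕ : Filter ℕ),
      |divPairing (BV.toL1 u) (cutoffField i k) - boundaryFlux i u| < ε / 2 :=
    Metric.tendsto_nhds.1 (tendsto_boundaryFlux i u) _ (half_pos hε)
  obtain ⟨k, hk1, hk2⟩ := (hev.and hclose).exists
  set g := toDualBV d (φ, testToC0 (ψ - s • cutoffField i k)) with hg
  have hg1 : g (BV.one d) = s := by
    rw [hg, toDualBV_apply, divC0_one, add_zero]
  have hgv : ∀ v, g v = integralPairing d (BV.toL1 v) φ + divPairing (BV.toL1 v) ψ -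
      s * divPairing (BV.toL1 v) (cutoffField i k) := fun v => by
    rw [hg, toDualBV_apply, map_sub, map_smul, map_sub, map_smul, divC0_testToC0, divC0_testToC0]
    simp only [sub_apply, smul_apply, divTest_apply, smul_eq_mul]
    ring
  refine ⟨_, add_smul_boundaryFlux_mem i (toDualBV_mem_W (φ, testToC0 (ψ - s • cutoffField i k))),
    ?_, ?_⟩
  · rw [← hg, hg1]
    refine ContinuousLinearMap.opNorm_le_bound _ zero_le_one fun v => ?_
    -- With `j` replaced by `div (χₗ eᵢ)`, the functional is `φ` plus the divergence of `ψ + s (χₗ -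
    -- χₖ) eᵢ`. This field has norm at most `1`: on the support of `ψ` both cutoffs are `1`, and off
    -- it only the second term remains, with `|s| ≤ 1`.
    have hlim : Tendsto (fun l => g v + s * divPairing (BV.toL1 v) (cutoffField i l))
        (hyperfilter ℕ : Filter ℕ) (𝓝 ((g + s • boundaryFlux i) v)) :=
      tendsto_const_nhds.add ((tendsto_boundaryFlux i v).const_mul s)
    refine le_of_tendsto hlim.norm (hev.mono fun l hl => ?_)
    have e : g v + s * divPairing (BV.toL1 v) (cutoffField i l) =
        toDualBV d (φ, testToC0 (ψ + s • (cutoffField i l - cutoffField i k))) v := by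
      rw [hgv, toDualBV_apply, map_add, map_smul, map_sub, map_add, map_smul, map_sub]
      simp only [divC0_testToC0, add_apply, sub_apply, smul_apply, divTest_apply, smul_eq_mul]
      ring
    rw [e]
    suffices hn : ∀ x, ‖(ψ + s • (cutoffField i l - cutoffField i k)) x‖ ≤ 1 from
      ContinuousLinearMap.le_of_opNorm_le _ (norm_toDualBV_testToC0_le h1 hn) v
    intro x
    rw [add_apply, smul_apply, sub_apply]
    by_cases hx : x ∈ tsupport ψ
    · rw [cutoffField_apply, cutoffField_apply, cutoff_eq_one (hn l hl hx),
        cutoff_eq_one (hn k hk1 hx), sub_self, smul_zero, add_zero]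
      exact h2 x
    · rw [image_eq_zero_of_notMem_tsupport hx, zero_add, cutoffField_apply, cutoffField_apply,
        ← sub_smul, norm_smul, norm_smul]
      have b : |cutoff d l x - cutoff d k x| ≤ 1 := by
        rw [abs_le]
        constructor <;> linarith [(cutoff_mem_Icc l x).1, (cutoff_mem_Icc l x).2,
          (cutoff_mem_Icc k x).1, (cutoff_mem_Icc k x).2]
      simp only [PiLp.norm_single, norm_one, mul_one, Real.norm_eq_abs]
      exact mul_le_one₀ hs1 (abs_nonneg _) b
  · rw [← hg, hg1]
    have e : (g + s • boundaryFlux i) u = integralPairing d (BV.toL1 u) φ +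
        divPairing (BV.toL1 u) ψ -
        s * (divPairing (BV.toL1 u) (cutoffField i k) - boundaryFlux i u) := by
      rw [add_apply, smul_apply, hgv, smul_eq_mul]
      ring
    rw [e]
    have b : |s * (divPairing (BV.toL1 u) (cutoffField i k) - boundaryFlux i u)| ≤ ε / 2 := by
      rw [abs_mul]
      exact (mul_le_of_le_one_left (abs_nonneg _) hs1).trans hk2.le
    linarith [le_abs_self (s * (divPairing (BV.toL1 u) (cutoffField i k) - boundaryFlux i u))]

theorem isIsometricPredual_fluxPredual (i : Fin d) : IsIsometricPredual (fluxPredual i) := by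
  refine ⟨isClosed_W.preimage (fluxShift i).continuous,
    isometry_dualityMap fun u ε hε => exists_fluxPredual_gt i u hε, fun ℓ => ?_⟩
  let R : StrongDual ℝ (BV d) →L[ℝ] StrongDual ℝ (BV d) :=
    ContinuousLinearMap.id ℝ _ +
      (inclusionInDoubleDual ℝ (BV d) (BV.one d)).smulRight (boundaryFlux i)
  let R' : W d →L[ℝ] fluxPredual i := (R.comp (W d).subtypeL).codRestrict (fluxPredual i)
    fun g => add_smul_boundaryFlux_mem i g.2
  obtain ⟨v, hv⟩ := isIsometricPredual_W.2.2 (ℓ.comp R')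
  -- This is the adjoint of `fluxShift` applied to `v`: `f (v - j(v) 1) = (f - f(1) j) v`.
  refine ⟨v - boundaryFlux i v • BV.one d, ?_⟩
  ext f
  have hf : fluxShift i f.1 ∈ W d := f.2
  have h := DFunLike.congr_fun hv (⟨fluxShift i f.1, hf⟩ : W d)
  have hR : R' ⟨fluxShift i f.1, hf⟩ = f := by
    refine Subtype.ext ?_
    change fluxShift i f.1 + (fluxShift i f.1) (BV.one d) • boundaryFlux i = f.1
    rw [fluxShift_apply, sub_apply, smul_apply, boundaryFlux_one, smul_zero, sub_zero,
      sub_add_cancel]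
  rw [ContinuousLinearMap.comp_apply, hR] at h
  have h' : (fluxShift i f.1) v = ℓ f := h
  rw [← h', dualityMap_apply, fluxShift_apply, sub_apply, smul_apply, map_sub, map_smul,
    smul_eq_mul, smul_eq_mul, mul_comm]

end SecondPredual

end

theorem theorem6p5 (d : ℕ) (hd : 1 ≤ d) :
    IsIsometricPredual (W d) ∧
    ¬ IsStronglyUniquePredual ↥(W d) ∧
    ∃ P : Submodule ℝ (StrongDual ℝ (BV d)), IsIsometricPredual P ∧ P ≠ W d :=
  ⟨isIsometricPredual_W,
    not_isStronglyUniquePredual isIsometricPredual_W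
      (isIsometricPredual_fluxPredual ⟨0, hd⟩) (fluxPredual_ne_W ⟨0, hd⟩),
    fluxPredual ⟨0, hd⟩, isIsometricPredual_fluxPredual ⟨0, hd⟩, fluxPredual_ne_W ⟨0, hd⟩⟩
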